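/- **Setting.** Let $K$ be a field of characteristic $0$, complete with respect to a nonarchimedean norm $|\cdot|$ with $|p|=p^{-1}$ for a prime $p$, let $n\ge 1$ and $\rho\in\mathbb R_{>0}^n$. Let $\Gamma_k$ be the group of $p^k$-th roots of unity in a fixed algebraic closure of $K$, $\Gamma=\bigcup_k\Gamma_k$, and give $K(\Gamma)$ the unique norm extending that of $K$. For a closed polysegment $J=\prod_i[\alpha_i,\beta_i]$ with $0<\alpha_i<\rho_i<\beta_i$ (a closed polysegment containing $\rho$ in its interior) let $K_{J,n}$ be the ring of Laurent series $f=\sum_{i\in\mathbb Z^n}f_it^i$ over $K$ with $|f_i|\sigma^i\to0$ as $|i|\to\infty$ for every $\sigma\in J$, put $|f|_\sigma=\max_i|f_i|\sigma^i$ and $|f|_J=\max_{\sigma\in J}|f|_\sigma$, and use the same notation on $K_{J,n}\otimes_KK(\Gamma)$ and, taking the maximum over the entries, for matrices. Let $R_\rho=\varinjlim_JK_{J,n}$. The group $\Gamma^n$ acts $K(\Gamma)$-linearly on $K_{J,n}\otimes_KK(\Gamma)$ and on $R_\rho\otimes_KK(\Gamma)$ by $\zeta^*f(t)=f(\zeta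 t)$. **The category $\mathscr C_\rho$.** An object of $\mathscr C_\rho$ is a finite free $R_\rho$-module $P$ with a semilinear group action of $\Gamma^n$ on $P\otimes_KK(\Gamma)$ such that $\tau(\zeta^*x)=\tau(\zeta)^*(\tau x)$ for all $\tau\in\mathrm{Gal}(K(\Gamma)/K)$, $\zeta\in\Gamma^n$, $x\in P\otimes_KK(\Gamma)$, and such that $P$ is *defined by* some $P'$ over some $J$ as above. The latter means: $P'$ is a finite free $K_{J,n}$-module with a semilinear action of $\Gamma^n$ on $P'\otimes_KK(\Gamma)$; $P\cong R_\rho\otimes_{K_{J,n}}P'$, and the action on $P\otimes_KK(\Gamma)$ is induced from that on $P'\otimes_KK(\Gamma)$; and for some basis of $P'$ there is $l>0$ such that the matrix $E(\zeta)$ of $\zeta^*$ satisfies $|E(\zeta)|_J\le p^{lk}$ for all $k\ge1$ and $\zeta\in\Gamma_k^n$. **Exponents.** Let $P$ be an object of $\mathscr C_\rho$ of rank $m$ defined by $P'$ over $J$, and let $e_1,\dots,e_m$ be a basis of $P'$. A multiset $A=(A_1,\dots,A_m)$ in $\mathbb Z_p^n$ is an *exponent of $P$ defined by $P'$* if there are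 $m\times m$ matrices $S_k$ ($k\ge1$) over $K_{J,n}$ such that: (1) if $(v_{k,1},\dots,v_{k,m})=(e_1,\dots,e_m)S_k$, then $\zeta^*(v_{k,j})=\zeta^{A_j}v_{k,j}$ for all $j$ and all $\zeta\in\Gamma_k^n$; (2) there is $l>0$ with $|S_k|_J\le p^{lk}$ for all $k$; (3) $|\det S_k|_\sigma\ge1$ for all $k$ and all $\sigma\in J$. (This does not depend on the basis.) $A$ is an *exponent of $P$* if it is an exponent of $P$ defined by some $P'$ over some closed polysegment containing $\rho$ in its interior. **Weak equivalence.** For $x\in\mathbb Q_p$ let $\langle x\rangle$ be the smallest nonnegative $a\in\mathbb Z[1/p]$ such that $x-a$ or $x+a$ lies in $\mathbb Z_p$. Multisets $A=(A_1,\dots,A_m)$ and $B=(B_1,\dots,B_m)$ in $\mathbb Z_p^n$ are *weakly equivalent* if there are $c>0$ and permutations $\sigma_h$ ($h\ge1$) of $\{1,\dots,m\}$ with $$p^h\left\langle \frac{A^i_{\sigma_h(j)}-B^i_j}{p^h}\right\rangle\le ch\qquad(h\ge1,\ 1\le i\le n,\ 1\le j\le m),$$ where $A^i_j$ denotes the $i$-th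 entry of $A_j$. **Theorem.** Let $P$ be an object of $\mathscr C_\rho$ that is defined by $P_1$ over $J_1$ and by $P_2$ over $J_2$, where $J_1,J_2$ are closed polysegments containing $\rho$ in their interiors. Then every exponent of $P$ defined by $P_1$ is weakly equivalent to every exponent of $P$ defined by $P_2$. In particular, any two exponents of $P$ are weakly equivalent. -/

import Mathlib

universe u v w w₁ w₂

noncomputable section

namespace PFuchs

open Filter Topology TensorProduct

/-- The space `ℝ_{>0}^n` of multiradii. -/
abbrev Radius (n : ℕ) : Type := Fin n → {x : ℝ // 0 < x}

/-- The monomial `σ^i = σ₁^{i₁} ⋯ σₙ^{iₙ}`. -/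
def Radius.mono {n : ℕ} (σ : Radius n) (i : Fin n → ℤ) : ℝ := ∏ r, (σ r : ℝ) ^ i r

theorem Radius.mono_pos {n : ℕ} (σ : Radius n) (i : Fin n → ℤ) : 0 < σ.mono i :=
  Finset.prod_pos fun r _ => zpow_pos (σ r).2 _

theorem Radius.mono_add {n : ℕ} (σ : Radius n) (i j : Fin n → ℤ) :
    σ.mono (i + j) = σ.mono i * σ.mono j := by
  simp only [Radius.mono, Pi.add_apply, ← Finset.prod_mul_distrib]
  exact Finset.prod_congr rfl fun r _ => zpow_add₀ (σ r).2.ne' _ _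

theorem Radius.mono_zero {n : ℕ} (σ : Radius n) : σ.mono 0 = 1 := by
  simp [Radius.mono]

section Ring

variable {K : Type u} [NontriviallyNormedField K] {n : ℕ}

/-- The formal Laurent series `∑ fᵢ tⁱ` satisfies `|fᵢ| σ^i → 0` as `|i| → ∞`. -/
def ConvergesAt (f : (Fin n → ℤ) → K) (σ : Radius n) : Prop :=
  Tendsto (fun i => ‖f i‖ * σ.mono i) cofinite (𝓝 0)

/-- The product of formal Laurent series. -/
def convol (f g : (Fin n → ℤ) → K) : (Fin n → ℤ) → K :=
  fun i => ∑' j, f j * g (i - j)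

theorem tendsto_mul_cofinite {ι κ : Type*} {a : ι → ℝ} {b : κ → ℝ}
    (ha : Tendsto a cofinite (𝓝 0)) (hb : Tendsto b cofinite (𝓝 0)) :
    Tendsto (fun x : ι × κ => a x.1 * b x.2) cofinite (𝓝 0) :=
  tendsto_mul_cofinite_nhds_zero ha hb

theorem ConvergesAt.zero (σ : Radius n) : ConvergesAt (0 : (Fin n → ℤ) → K) σ := by
  simp [ConvergesAt, tendsto_const_nhds]

theorem ConvergesAt.neg {f : (Fin n → ℤ) → K} {σ : Radius n} (hf : ConvergesAt f σ) :
    ConvergesAt (-f) σ := by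
  simpa [ConvergesAt] using hf

theorem ConvergesAt.of_le {f g : (Fin n → ℤ) → K} {σ : Radius n} (hf : ConvergesAt f σ)
    (h : ∀ i, ‖g i‖ ≤ ‖f i‖) : ConvergesAt g σ :=
  squeeze_zero (fun i => mul_nonneg (norm_nonneg _) (σ.mono_pos i).le)
    (fun i => mul_le_mul_of_nonneg_right (h i) (σ.mono_pos i).le) hf

theorem ConvergesAt.add {f g : (Fin n → ℤ) → K} {σ : Radius n} (hf : ConvergesAt f σ)
    (hg : ConvergesAt g σ) : ConvergesAt (f + g) σ := by
  have h := Tendsto.add hf hg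
  rw [add_zero] at h
  refine squeeze_zero (fun i => mul_nonneg (norm_nonneg _) (σ.mono_pos i).le) (fun i => ?_) h
  rw [← add_mul]
  exact mul_le_mul_of_nonneg_right (norm_add_le _ _) (σ.mono_pos i).le

theorem ConvergesAt.smul {f : (Fin n → ℤ) → K} {σ : Radius n} (c : K) (hf : ConvergesAt f σ) :
    ConvergesAt (c • f) σ := by
  have h := Tendsto.const_mul ‖c‖ hf
  rw [mul_zero] at h
  simpa [ConvergesAt, mul_assoc] using h

theorem ConvergesAt.single (c : K) (σ : Radius n) :
    ConvergesAt (Pi.single (0 : Fin n → ℤ) c) σ := by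
  refine tendsto_nhds_of_eventually_eq ?_
  refine (Set.finite_singleton (0 : Fin n → ℤ)).subset fun i hi => ?_
  by_contra h
  exact hi (by simp [Pi.single_eq_of_ne h])

theorem ConvergesAt.tendsto_prod {f g : (Fin n → ℤ) → K} {σ : Radius n} (hf : ConvergesAt f σ)
    (hg : ConvergesAt g σ) :
    Tendsto (fun x : (Fin n → ℤ) × (Fin n → ℤ) => ‖f x.1 * g x.2‖ * σ.mono (x.1 + x.2))
      cofinite (𝓝 0) := by
  refine (tendsto_mul_cofinite hf hg).congr fun x => ?_
  rw [norm_mul, Radius.mono_add]; ring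

theorem convol_comm (f g : (Fin n → ℤ) → K) : convol f g = convol g f := by
  funext i
  rw [convol, convol, ← (Equiv.subLeft i).tsum_eq]
  simp [mul_comm]

theorem convol_single (c : K) (f : (Fin n → ℤ) → K) :
    convol (Pi.single 0 c) f = c • f := by
  funext i
  rw [convol, tsum_eq_single 0]
  · simp
  · intro j hj
    simp [Pi.single_eq_of_ne hj]

variable [IsUltrametricDist K]

theorem ConvergesAt.convol {f g : (Fin n → ℤ) → K} {σ : Radius n}
    (hf : ConvergesAt f σ) (hg : ConvergesAt g σ) : ConvergesAt (convol f g) σ := by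
  rw [ConvergesAt, Metric.tendsto_nhds]
  intro ε hε
  have h := (Metric.tendsto_nhds.1 (hf.tendsto_prod hg)) (ε / 2) (half_pos hε)
  refine (Set.Finite.image (fun x => x.1 + x.2) h).subset fun i hi => ?_
  by_contra hcon
  apply hi
  have hle : ∀ j, ‖f j * g (i - j)‖ ≤ ε / 2 * (σ.mono i)⁻¹ := by
    intro j
    by_contra hj
    refine hcon ⟨(j, i - j), ?_, by simp⟩
    intro hlt
    apply hj
    have h0 : (0 : ℝ) ≤ ‖f j * g (i - j)‖ * σ.mono i :=
      mul_nonneg (norm_nonneg _) (σ.mono_pos i).le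
    simp only [Set.mem_ofPred_eq, add_sub_cancel, dist_zero_right, Real.norm_of_nonneg h0] at hlt
    rw [← div_eq_mul_inv, le_div_iff₀ (σ.mono_pos i)]
    exact hlt.le
  have hs : ‖PFuchs.convol f g i‖ ≤ ε / 2 * (σ.mono i)⁻¹ :=
    IsUltrametricDist.norm_tsum_le_of_forall_le_of_nonneg
      (mul_nonneg (half_pos hε).le (inv_nonneg.2 (σ.mono_pos i).le)) hle
  have h0 : (0 : ℝ) ≤ ‖PFuchs.convol f g i‖ * σ.mono i :=
    mul_nonneg (norm_nonneg _) (σ.mono_pos i).le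
  simp only [Set.mem_ofPred_eq, dist_zero_right, Real.norm_of_nonneg h0]
  rw [← div_eq_mul_inv, le_div_iff₀ (σ.mono_pos i)] at hs
  linarith

variable [CompleteSpace K]

theorem summable_of_norm_tendsto {ι : Type*} {f : ι → K}
    (h : Tendsto (fun i => ‖f i‖) cofinite (𝓝 0)) : Summable f :=
  NonarchimedeanAddGroup.summable_of_tendsto_cofinite_zero (tendsto_zero_iff_norm_tendsto_zero.2 h)

theorem ConvergesAt.summable_convol {f g : (Fin n → ℤ) → K} {σ : Radius n}
    (hf : ConvergesAt f σ) (hg : ConvergesAt g σ) (i : Fin n → ℤ) :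
    Summable fun j => f j * g (i - j) := by
  apply summable_of_norm_tendsto
  have hinj : Function.Injective fun j : Fin n → ℤ => (j, i - j) := fun a b h => (Prod.ext_iff.1 h).1
  have h := ((hf.tendsto_prod hg).comp hinj.tendsto_cofinite).mul_const (σ.mono i)⁻¹
  rw [zero_mul] at h
  refine h.congr fun j => ?_
  simp [mul_assoc, (σ.mono_pos i).ne']

theorem convol_assoc {f g h : (Fin n → ℤ) → K} {σ : Radius n}
    (hf : ConvergesAt f σ) (hg : ConvergesAt g σ) (hh : ConvergesAt h σ) :
    convol (convol f g) h = convol f (convol g h) := by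
  funext i
  have hsum : Summable (Function.uncurry fun k j => f j * g (k - j) * h (i - k)) := by
    apply summable_of_norm_tendsto
    have h3 := tendsto_mul_cofinite hf (tendsto_mul_cofinite hg hh)
    have hinj : Function.Injective fun x : (Fin n → ℤ) × (Fin n → ℤ) =>
        (x.2, (x.1 - x.2, i - x.1)) := by
      rintro ⟨a, b⟩ ⟨c, d⟩ h
      simp only [Prod.mk.injEq] at h
      obtain ⟨rfl, h, -⟩ := h
      exact Prod.ext (sub_left_injective h) rfl
    have h4 := (h3.comp hinj.tendsto_cofinite).mul_const (σ.mono i)⁻¹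
    rw [zero_mul] at h4
    refine h4.congr fun x => ?_
    have he : σ.mono i = σ.mono x.2 * (σ.mono (x.1 - x.2) * σ.mono (i - x.1)) := by
      rw [← Radius.mono_add, ← Radius.mono_add]; congr 1; abel
    simp only [Function.comp, Function.uncurry, norm_mul]
    rw [mul_inv_eq_iff_eq_mul₀ (σ.mono_pos i).ne', he]
    ring
  calc convol (convol f g) h i = ∑' k, ∑' j, f j * g (k - j) * h (i - k) := by
        simp only [convol, tsum_mul_right]
    _ = ∑' j, ∑' k, f j * g (k - j) * h (i - k) := hsum.tsum_comm.symm
    _ = convol f (convol g h) i := by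
        refine tsum_congr fun j => ?_
        rw [convol, ← tsum_mul_left,
          ← (Equiv.subRight j).tsum_eq fun k => f j * (g k * h (i - j - k))]
        refine tsum_congr fun k => ?_
        rw [mul_assoc, Equiv.subRight_apply, sub_sub_sub_cancel_right]

theorem convol_add {f g h : (Fin n → ℤ) → K} {σ : Radius n}
    (hf : ConvergesAt f σ) (hg : ConvergesAt g σ) (hh : ConvergesAt h σ) :
    convol f (g + h) = convol f g + convol f h := by
  funext i
  simp only [convol, Pi.add_apply, mul_add]
  exact (hf.summable_convol hg i).tsum_add (hf.summable_convol hh i)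

end Ring

/-- The formal Laurent series in `n` variables over `K` that converge at all radii `σ` which are
eventual in `𝓕`. For `𝓕 = 𝓟 J` this is the ring `K_{J,n}` of the polyannulus of radius `J`
(convergence at every `σ ∈ J`); for `𝓕 = 𝓝 ρ` it is the union of the rings `K_{J,n}` over the closed
polysegments `J` that contain `ρ` in the interior. -/
def LaurentRing (K : Type u) [NontriviallyNormedField K] {n : ℕ} (𝓕 : Filter (Radius n)) : Type u :=
  {f : (Fin n → ℤ) → K // ∀ᶠ σ in 𝓕, ConvergesAt f σ}

namespace LaurentRing

variable {K : Type u} [NontriviallyNormedField K] {n : ℕ} {𝓕 : Filter (Radius n)}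

@[ext]
theorem ext {f g : LaurentRing K 𝓕} (h : f.1 = g.1) : f = g := Subtype.ext h

instance : Zero (LaurentRing K 𝓕) := ⟨⟨0, .of_forall fun σ => .zero σ⟩⟩
instance : One (LaurentRing K 𝓕) := ⟨⟨Pi.single 0 1, .of_forall fun σ => .single 1 σ⟩⟩
instance : Add (LaurentRing K 𝓕) :=
  ⟨fun f g => ⟨f.1 + g.1, by filter_upwards [f.2, g.2] with σ hf hg using hf.add hg⟩⟩
instance : Neg (LaurentRing K 𝓕) := ⟨fun f => ⟨-f.1, f.2.mono fun _ hf => hf.neg⟩⟩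
instance : SMul K (LaurentRing K 𝓕) := ⟨fun c f => ⟨c • f.1, f.2.mono fun _ hf => hf.smul c⟩⟩

variable [CompleteSpace K] [IsUltrametricDist K]

instance : Mul (LaurentRing K 𝓕) :=
  ⟨fun f g => ⟨convol f.1 g.1, by filter_upwards [f.2, g.2] with σ hf hg using hf.convol hg⟩⟩

instance [NeBot 𝓕] : CommRing (LaurentRing K 𝓕) where
  add_assoc f g h := ext (add_assoc f.1 g.1 h.1)
  zero_add f := ext (zero_add f.1)
  add_zero f := ext (add_zero f.1)
  add_comm f g := ext (add_comm f.1 g.1)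
  neg_add_cancel f := ext (neg_add_cancel f.1)
  nsmul := nsmulRec
  zsmul := zsmulRec
  mul_comm f g := ext (convol_comm f.1 g.1)
  mul_assoc f g h := by
    obtain ⟨σ, ⟨hf, hg⟩, hh⟩ := ((f.2.and g.2).and h.2).exists
    exact ext (convol_assoc hf hg hh)
  one_mul f := ext ((convol_single 1 f.1).trans (one_smul K f.1))
  mul_one f := ext ((convol_comm f.1 _).trans ((convol_single 1 f.1).trans (one_smul K f.1)))
  left_distrib f g h := by
    obtain ⟨σ, ⟨hf, hg⟩, hh⟩ := ((f.2.and g.2).and h.2).exists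
    exact ext (convol_add hf hg hh)
  right_distrib f g h := by
    obtain ⟨σ, ⟨hf, hg⟩, hh⟩ := ((f.2.and g.2).and h.2).exists
    refine ext ?_
    change convol (f.1 + g.1) h.1 = convol f.1 h.1 + convol g.1 h.1
    rw [convol_comm, convol_add hh hf hg, convol_comm h.1 f.1, convol_comm h.1 g.1]
  zero_mul f := ext (by funext i; change ∑' j, (0 : K) * f.1 (i - j) = 0; simp)
  mul_zero f := ext (by funext i; change ∑' j, f.1 j * (0 : K) = 0; simp)

instance [NeBot 𝓕] : Algebra K (LaurentRing K 𝓕) where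
  algebraMap :=
    { toFun := fun c => ⟨Pi.single 0 c, .of_forall fun σ => .single c σ⟩
      map_one' := rfl
      map_zero' := ext (Pi.single_zero _)
      map_add' := fun a b => ext (Pi.single_add _ _ _)
      map_mul' := fun a b => ext (by
        change _ = convol (Pi.single 0 a) (Pi.single 0 b)
        rw [convol_single, ← Pi.single_smul, smul_eq_mul]) }
  commutes' c f := mul_comm _ _
  smul_def' c f := ext (convol_single c f.1).symm

/-- The inclusion of rings of convergent Laurent series given by shrinking the set of radii. -/
def restrict {𝓕 𝓖 : Filter (Radius n)} [NeBot 𝓕] [NeBot 𝓖] (h : 𝓖 ≤ 𝓕) :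
    LaurentRing K 𝓕 →ₐ[K] LaurentRing K 𝓖 where
  toFun f := ⟨f.1, f.2.filter_mono h⟩
  map_one' := rfl
  map_mul' _ _ := rfl
  map_zero' := rfl
  map_add' _ _ := rfl
  commutes' _ := rfl

/-- The `i`-th coefficient. -/
def coeff [NeBot 𝓕] (i : Fin n → ℤ) : LaurentRing K 𝓕 →ₗ[K] K where
  toFun f := f.1 i
  map_add' _ _ := rfl
  map_smul' _ _ := rfl

open Classical in
/-- The part of the series `f` that is supported on `s`. -/
def part [NeBot 𝓕] (s : Set (Fin n → ℤ)) : LaurentRing K 𝓕 →ₗ[K] LaurentRing K 𝓕 where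
  toFun f := ⟨fun i => if i ∈ s then f.1 i else 0, f.2.mono fun _ hf => hf.of_le fun i => by
    split_ifs <;> simp⟩
  map_add' f g := ext (by
    funext i
    change (if i ∈ s then f.1 i + g.1 i else 0) = (if i ∈ s then f.1 i else 0) + if i ∈ s then g.1 i else 0
    split_ifs <;> simp)
  map_smul' c f := ext (by
    funext i
    change (if i ∈ s then c * f.1 i else 0) = c * if i ∈ s then f.1 i else 0
    split_ifs <;> simp)

/-- The `σ`-Gauss norm `|f|_σ = max_i |fᵢ| σ^i`. -/
def gaussNorm [NeBot 𝓕] (σ : Radius n) (f : LaurentRing K 𝓕) : ℝ := ⨆ i, ‖coeff i f‖ * σ.mono i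

end LaurentRing

section Gamma

variable (K : Type u) [NontriviallyNormedField K] (p : ℕ)

/-- The field `K(Γ)` generated by the `p`-power roots of unity in an algebraic closure of `K`. -/
abbrev KGamma : IntermediateField K (AlgebraicClosure K) :=
  IntermediateField.adjoin K {z | ∃ k : ℕ, z ^ p ^ k = 1}

/-- The group `Γ^n` of `n`-tuples of `p`-power roots of unity (they all lie in `K(Γ)`). -/
def GammaPow (n : ℕ) : Subgroup (Fin n → (KGamma K p)ˣ) where
  carrier := {ζ | ∃ k : ℕ, ∀ r, ζ r ^ p ^ k = 1}
  one_mem' := ⟨0, fun _ => one_pow _⟩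
  mul_mem' := by
    rintro ζ η ⟨k, hk⟩ ⟨l, hl⟩
    refine ⟨k + l, fun r => ?_⟩
    rw [Pi.mul_apply, mul_pow, pow_add, pow_mul, hk, one_pow, mul_comm (p ^ k), pow_mul, hl,
      one_pow, one_mul]
  inv_mem' := by
    rintro ζ ⟨k, hk⟩
    exact ⟨k, fun r => by rw [Pi.inv_apply, inv_pow, hk, inv_one]⟩

variable {K p} {n : ℕ}

/-- `ζ` lies in `Γ_k^n`, i.e. its entries are `p^k`-th roots of unity. -/
def GammaPow.InLevel (ζ : GammaPow K p n) (k : ℕ) : Prop := ∀ r, ζ.1 r ^ p ^ k = 1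

/-- The action of `Gal(K(Γ)/K)` on `Γ^n`. -/
def GammaPow.gal (τ : KGamma K p ≃ₐ[K] KGamma K p) (ζ : GammaPow K p n) : GammaPow K p n :=
  ⟨fun r => Units.map (τ : KGamma K p →* KGamma K p) (ζ.1 r), by
    obtain ⟨k, hk⟩ := ζ.2
    exact ⟨k, fun r => by rw [← map_pow, hk, map_one]⟩⟩

/-- `ζ^a = ζ₁^{a₁} ⋯ ζₙ^{aₙ}` for `ζ ∈ Γ_k^n` and `a ∈ ℤ_p^n`; it depends only on `a` modulo `p^k`. -/
def GammaPow.padicPow [Fact p.Prime] (ζ : GammaPow K p n) (k : ℕ) (a : Fin n → ℤ_[p]) : KGamma K p :=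
  ∏ r, (ζ.1 r : KGamma K p) ^ (PadicInt.toZModPow k (a r)).val

variable [CompleteSpace K] [IsUltrametricDist K] {𝓕 : Filter (Radius n)} [NeBot 𝓕]

variable (𝓕) in
/-- `K_{J,n} ⊗_K K(Γ)`, respectively `R_ρ ⊗_K K(Γ)`. -/
abbrev LaurentRingGamma (K : Type u) [NontriviallyNormedField K] (p : ℕ) [CompleteSpace K]
    [IsUltrametricDist K] : Type u := LaurentRing K 𝓕 ⊗[K] KGamma K p

/-- The `i`-th coefficient, in `K(Γ)`, of an element of `K_{J,n} ⊗_K K(Γ)`. -/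
def LaurentRingGamma.coeff (i : Fin n → ℤ) : LaurentRingGamma 𝓕 K p →ₗ[K] KGamma K p :=
  (TensorProduct.lid K (KGamma K p)).toLinearMap ∘ₗ
    LinearMap.rTensor (KGamma K p) (LaurentRing.coeff i)

/-- The `σ`-Gauss norm on `K_{J,n} ⊗_K K(Γ)`; `K(Γ)` carries the unique norm extending that of `K`. -/
def LaurentRingGamma.gaussNorm (σ : Radius n) (f : LaurentRingGamma 𝓕 K p) : ℝ :=
  ⨆ i, spectralNorm K (KGamma K p) (LaurentRingGamma.coeff i f) * σ.mono i

/-- The `K(Γ)`-linear action `f(t) ↦ f(ζt)` of `ζ ∈ Γ^n` on `K_{J,n} ⊗_K K(Γ)`. If `N` is the order of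
`ζ`, the factor `ζ^i` depends only on `i` modulo `N`, so that `f(ζt)` for `f ∈ K_{J,n}` is the finite
sum over the residue classes `a` modulo `N` of `ζ^a` times the part of `f` in the class `a`; see
`LaurentRingGamma.coeff_twist`. -/
def LaurentRingGamma.twist (ζ : GammaPow K p n) :
    LaurentRingGamma 𝓕 K p →ₗ[K] LaurentRingGamma 𝓕 K p :=
  ∑ a : Fin n → Fin (orderOf ζ),
    TensorProduct.map (LaurentRing.part {i | ∀ r, i r ≡ (a r : ℕ) [ZMOD orderOf ζ]})
      (LinearMap.mulLeft K (∏ r, (ζ.1 r : KGamma K p) ^ (a r : ℕ)))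

theorem LaurentRingGamma.coeff_twist [hp : Fact p.Prime] (ζ : GammaPow K p n) (i : Fin n → ℤ)
    (f : LaurentRingGamma 𝓕 K p) :
    coeff i (twist ζ f) = ((∏ r, ζ.1 r ^ i r : (KGamma K p)ˣ) : KGamma K p) * coeff i f := by
  classical
  have hN : 0 < orderOf ζ := by
    obtain ⟨k, hk⟩ := ζ.2
    exact orderOf_pos_iff.2 (isOfFinOrder_iff_pow_eq_one.2
      ⟨p ^ k, pow_pos hp.out.pos k, Subtype.ext (funext fun r => hk r)⟩)
  have hN' : (orderOf ζ : ℤ) ≠ 0 := by exact_mod_cast hN.ne'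
  have hζ : ∀ r, ζ.1 r ^ (orderOf ζ : ℤ) = 1 := fun r => by
    have h := congrFun (congrArg Subtype.val (pow_orderOf_eq_one ζ)) r
    rw [zpow_natCast]
    exact h
  have hb : ∀ r, (i r % orderOf ζ).toNat < orderOf ζ := fun r => by
    have h0 := Int.emod_nonneg (i r) hN'
    have h1 := Int.emod_lt_of_pos (i r) (Int.natCast_pos.2 hN)
    omega
  induction f using TensorProduct.induction_on with
  | zero => simp
  | add x y hx hy => rw [map_add, map_add, map_add, mul_add, hx, hy]
  | tmul g c =>
    have key : ∀ a : Fin n → Fin (orderOf ζ),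
        coeff i (TensorProduct.map
          (LaurentRing.part {i | ∀ r, i r ≡ (a r : ℕ) [ZMOD orderOf ζ]})
          (LinearMap.mulLeft K (∏ r, (ζ.1 r : KGamma K p) ^ (a r : ℕ))) (g ⊗ₜ[K] c)) =
        if a = fun r => ⟨(i r % orderOf ζ).toNat, hb r⟩ then
          ((∏ r, ζ.1 r ^ i r : (KGamma K p)ˣ) : KGamma K p) * coeff i (g ⊗ₜ[K] c) else 0 := by
      intro a
      have hiff : (∀ r, i r ≡ (a r : ℕ) [ZMOD orderOf ζ]) ↔
          a = fun r => ⟨(i r % orderOf ζ).toNat, hb r⟩ := by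
        rw [funext_iff]
        refine forall_congr' fun r => ?_
        have h0 := Int.emod_nonneg (i r) hN'
        have ha := Int.emod_eq_of_lt (Int.natCast_nonneg (a r : ℕ))
          (Int.ofNat_lt.2 (a r).2)
        rw [Int.ModEq, ha, Fin.ext_iff]
        simp only
        omega
      have hc : coeff i (TensorProduct.map
          (LaurentRing.part {i | ∀ r, i r ≡ (a r : ℕ) [ZMOD orderOf ζ]})
          (LinearMap.mulLeft K (∏ r, (ζ.1 r : KGamma K p) ^ (a r : ℕ))) (g ⊗ₜ[K] c)) =
          (if (∀ r, i r ≡ (a r : ℕ) [ZMOD orderOf ζ]) then g.1 i else 0) •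
            ((∏ r, (ζ.1 r : KGamma K p) ^ (a r : ℕ)) * c) := by
        simp only [coeff, LaurentRing.coeff, LaurentRing.part, LinearMap.comp_apply,
          TensorProduct.map_tmul, LinearMap.rTensor_tmul, LinearEquiv.coe_coe,
          TensorProduct.lid_tmul, LinearMap.coe_mk, AddHom.coe_mk, LinearMap.mulLeft_apply,
          Set.mem_ofPred_eq]
        congr 1
        change (@ite _ (∀ r, i r ≡ (a r : ℕ) [ZMOD orderOf ζ]) (Classical.propDecidable _) _ _) = _
        congr
      rw [hc]
      by_cases h : ∀ r, i r ≡ (a r : ℕ) [ZMOD orderOf ζ]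
      · rw [if_pos h, if_pos (hiff.1 h)]
        have hpow : (∏ r, (ζ.1 r : KGamma K p) ^ (a r : ℕ)) =
            ((∏ r, ζ.1 r ^ i r : (KGamma K p)ˣ) : KGamma K p) := by
          rw [Units.coe_prod]
          refine Finset.prod_congr rfl fun r _ => ?_
          obtain ⟨q, hq⟩ := (h r).dvd
          have : i r = (a r : ℕ) + orderOf ζ * (-q) := by linarith
          rw [this, zpow_add, zpow_mul, hζ, one_zpow, mul_one, zpow_natCast, Units.val_pow_eq_pow_val]
        rw [hpow]
        simp [coeff, LaurentRing.coeff]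
      · rw [if_neg h, if_neg (fun h' => h (hiff.2 h')), zero_smul]
    rw [twist, LinearMap.sum_apply, map_sum, Finset.sum_congr rfl fun a _ => key a]
    simp

end Gamma

section Objects

variable (K : Type u) [NontriviallyNormedField K] [CompleteSpace K] [IsUltrametricDist K]
  (p : ℕ) {n : ℕ}

/-- The natural action of `K_{J,n} ⊗_K K(Γ)` on `P ⊗_K K(Γ)` for a `K_{J,n}`-module `P`:
`(f ⊗ c) (x ⊗ d) = (f x) ⊗ (c d)`. -/
def scalarAction (𝓕 : Filter (Radius n)) [NeBot 𝓕] (P : Type v) [AddCommGroup P] [Module K P]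
    [Module (LaurentRing K 𝓕) P] [IsScalarTower K (LaurentRing K 𝓕) P] :
    LaurentRingGamma 𝓕 K p →ₐ[K] Module.End K (P ⊗[K] KGamma K p) :=
  (Module.endTensorEndAlgHom (R := K) (S := K) (A := K)).comp
    (Algebra.TensorProduct.map (Algebra.lsmul K K P) (Algebra.lsmul K K (KGamma K p)))

/-- A module `P` over `K_{J,n}` (or `R_ρ`) with a semilinear group action of `Γ^n` on
`P ⊗_K K(Γ)`. -/
structure GammaModule (𝓕 : Filter (Radius n)) [NeBot 𝓕] where
  carrier : Type v
  [addCommGroup : AddCommGroup carrier]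
  [moduleK : Module K carrier]
  [module : Module (LaurentRing K 𝓕) carrier]
  [isScalarTower : IsScalarTower K (LaurentRing K 𝓕) carrier]
  act : GammaPow K p n →* Module.End K (carrier ⊗[K] KGamma K p)
  semilinear : ∀ (ζ : GammaPow K p n) (c : LaurentRingGamma 𝓕 K p) (x : carrier ⊗[K] KGamma K p),
    act ζ (scalarAction K p 𝓕 carrier c x) =
      scalarAction K p 𝓕 carrier (LaurentRingGamma.twist ζ c) (act ζ x)

attribute [instance] GammaModule.addCommGroup GammaModule.moduleK GammaModule.module
  GammaModule.isScalarTower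

/-- A closed polysegment `[α, β] = ∏ [αᵢ, βᵢ]` in `ℝ_{>0}^n` that contains `ρ` in its interior. -/
structure ClosedPolysegment (ρ : Radius n) where
  lo : Radius n
  hi : Radius n
  lo_lt : ∀ r, lo r < ρ r
  lt_hi : ∀ r, ρ r < hi r

namespace ClosedPolysegment

variable {ρ : Radius n}

def toSet (J : ClosedPolysegment ρ) : Set (Radius n) := Set.Icc J.lo J.hi

def filter (J : ClosedPolysegment ρ) : Filter (Radius n) := 𝓟 J.toSet

theorem mem_nhds (J : ClosedPolysegment ρ) : J.toSet ∈ 𝓝 ρ := by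
  rw [toSet, ← Set.pi_univ_Icc]
  exact set_pi_mem_nhds Set.finite_univ fun r _ => Icc_mem_nhds (J.lo_lt r) (J.lt_hi r)

theorem nhds_le (J : ClosedPolysegment ρ) : 𝓝 ρ ≤ J.filter := le_principal_iff.2 J.mem_nhds

instance (J : ClosedPolysegment ρ) : NeBot J.filter := neBot_of_le J.nhds_le

end ClosedPolysegment

variable {ρ : Radius n}

/-- The coordinate ring `K_{J,n}` of the closed polyannulus of radius `J`. -/
abbrev PolyannulusRing (J : ClosedPolysegment ρ) : Type u := LaurentRing K J.filter

variable (ρ) in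
/-- The ring `R_ρ`, the direct limit (union) of the rings `K_{J,n}` over all closed polysegments `J`
containing `ρ` in the interior. -/
abbrev GermRing : Type u := LaurentRing K (𝓝 ρ)

instance (J : ClosedPolysegment ρ) : Algebra (PolyannulusRing K J) (GermRing K ρ) :=
  (LaurentRing.restrict J.nhds_le).toRingHom.toAlgebra

instance (J : ClosedPolysegment ρ) : IsScalarTower K (PolyannulusRing K J) (GermRing K ρ) :=
  IsScalarTower.of_algebraMap_eq fun _ => rfl

variable {K p}

/-- The matrix `E(ζ)` of `ζ^*` with respect to a basis `e` of `P`: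
`ζ^*(e_j ⊗ 1) = ∑ᵢ E(ζ)ᵢⱼ (eᵢ ⊗ 1)`. -/
def GammaModule.reprMatrix {𝓕 : Filter (Radius n)} [NeBot 𝓕] (P : GammaModule.{u, v} K p 𝓕)
    {m : ℕ} (e : Module.Basis (Fin m) (LaurentRing K 𝓕) P.carrier) (ζ : GammaPow K p n) :
    Matrix (Fin m) (Fin m) (LaurentRingGamma 𝓕 K p) :=
  Matrix.of fun i j =>
    LinearMap.rTensor (KGamma K p) ((e.coord i).restrictScalars K) (P.act ζ (e j ⊗ₜ[K] 1))

/-- The map `P' ⊗_K K(Γ) → P ⊗_K K(Γ)` induced by an isomorphism `R_ρ ⊗ P' ≅ P`. -/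
def gammaMap {J : ClosedPolysegment ρ} {P' : GammaModule.{u, w} K p J.filter}
    {P : GammaModule.{u, v} K p (𝓝 ρ)}
    (φ : (GermRing K ρ ⊗[PolyannulusRing K J] P'.carrier) ≃ₗ[GermRing K ρ] P.carrier) :
    P'.carrier ⊗[K] KGamma K p →ₗ[K] P.carrier ⊗[K] KGamma K p :=
  LinearMap.rTensor (KGamma K p) (φ.toLinearMap.restrictScalars K ∘ₗ
    (TensorProduct.mk (PolyannulusRing K J) (GermRing K ρ) P'.carrier 1).restrictScalars K)

/-- `P` is defined by `P'` over `J`: `P'` is a finite free `K_{J,n}`-module with a semilinear action of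
`Γ^n` on `P' ⊗_K K(Γ)`, an isomorphism `R_ρ ⊗ P' ≅ P` under which the action on `P ⊗_K K(Γ)` is
induced from that on `P' ⊗_K K(Γ)`, and `|E(ζ)|_J ≤ p^{lk}` for all `ζ ∈ Γ_k^n` with respect to
some basis of `P'`. -/
structure Model (P : GammaModule.{u, v} K p (𝓝 ρ)) (J : ClosedPolysegment ρ) where
  toGammaModule : GammaModule.{u, w} K p J.filter
  extend : (GermRing K ρ ⊗[PolyannulusRing K J] toGammaModule.carrier) ≃ₗ[GermRing K ρ] P.carrier
  act_extend : ∀ (ζ : GammaPow K p n) (x : toGammaModule.carrier ⊗[K] KGamma K p),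
    gammaMap extend (toGammaModule.act ζ x) =
      P.act ζ (gammaMap extend x)
  bound : ∃ (m : ℕ) (e : Module.Basis (Fin m) (PolyannulusRing K J) toGammaModule.carrier),
    ∃ l : ℝ, 0 < l ∧ ∀ k : ℕ, 0 < k → ∀ ζ : GammaPow K p n, GammaPow.InLevel ζ k → ∀ i j, ∀ σ ∈ J.toSet,
      LaurentRingGamma.gaussNorm σ (toGammaModule.reprMatrix e ζ i j) ≤ (p : ℝ) ^ (l * k)

variable (K p ρ) in
/-- The objects of the category `𝒞_ρ`. -/
structure CObj where
  toGammaModule : GammaModule.{u, v} K p (𝓝 ρ)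
  finite : Module.Finite (GermRing K ρ) toGammaModule.carrier
  free : Module.Free (GermRing K ρ) toGammaModule.carrier
  exists_model : ∃ J : ClosedPolysegment ρ, Nonempty (Model.{u, v, u} toGammaModule J)
  equivariant : ∀ (τ : KGamma K p ≃ₐ[K] KGamma K p) (ζ : GammaPow K p n)
      (x : toGammaModule.carrier ⊗[K] KGamma K p),
    LinearMap.lTensor toGammaModule.carrier τ.toLinearMap (toGammaModule.act ζ x) =
      toGammaModule.act (GammaPow.gal τ ζ) (LinearMap.lTensor toGammaModule.carrier τ.toLinearMap x)

variable [Fact p.Prime]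

/-- The tuple `A = (A_1, …, A_m)` in `ℤ_p^n` is an exponent admitted by the model `P'` over `J`: for
a basis `e` of `P'` there are matrices `S_k` over `K_{J,n}`, `k ≥ 1`, such that the columns `v_j` of
`(e_1, …, e_m) S_k` satisfy `ζ^*(v_j) = ζ^{A_j} v_j` for `ζ ∈ Γ_k^n`, `|S_k|_J ≤ p^{lk}` for some
`l > 0` independent of `k`, and `|det S_k|_σ ≥ 1` for all `σ ∈ J`. -/
def Model.IsExponent {P : GammaModule.{u, v} K p (𝓝 ρ)} {J : ClosedPolysegment ρ}
    (P' : Model.{u, v, w} P J) {m : ℕ} (A : Fin m → Fin n → ℤ_[p]) : Prop :=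
  ∃ (e : Module.Basis (Fin m) (PolyannulusRing K J) P'.toGammaModule.carrier)
    (S : ℕ → Matrix (Fin m) (Fin m) (PolyannulusRing K J)),
    (∀ k : ℕ, 0 < k → ∀ ζ : GammaPow K p n, GammaPow.InLevel ζ k → ∀ j,
      P'.toGammaModule.act ζ ((∑ i, S k i j • e i) ⊗ₜ[K] 1) =
        (∑ i, S k i j • e i) ⊗ₜ[K] GammaPow.padicPow ζ k (A j)) ∧
    (∃ l : ℝ, 0 < l ∧ ∀ k : ℕ, 0 < k → ∀ i j, ∀ σ ∈ J.toSet,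
      LaurentRing.gaussNorm σ (S k i j) ≤ (p : ℝ) ^ (l * k)) ∧
    (∀ k : ℕ, 0 < k → ∀ σ ∈ J.toSet, 1 ≤ LaurentRing.gaussNorm σ (S k).det)

/-- `A` is an exponent of the object `P` of `𝒞_ρ`: it is admitted by some model of `P` over some
closed polysegment containing `ρ` in its interior. (Every model is isomorphic to one whose carrier
is `K_{J,n}^m`, in the universe of `K`.) -/
def CObj.IsExponent (P : CObj.{u, v} K p ρ) {m : ℕ} (A : Fin m → Fin n → ℤ_[p]) : Prop :=
  ∃ (J : ClosedPolysegment ρ) (P' : Model.{u, v, u} P.toGammaModule J), P'.IsExponent A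

end Objects

section Exponents

variable {p : ℕ} [Fact p.Prime]

/-- `⟨x⟩`: the smallest nonnegative `a ∈ ℤ[1/p]` such that `x - a` or `x + a` is a `p`-adic
integer. -/
def angle (x : ℚ_[p]) : ℝ :=
  sInf {a : ℝ | 0 ≤ a ∧ ∃ (b : ℤ) (s : ℕ), a = b / (p : ℝ) ^ s ∧
    (‖x - b / (p : ℚ_[p]) ^ s‖ ≤ 1 ∨ ‖x + b / (p : ℚ_[p]) ^ s‖ ≤ 1)}

/-- Weak equivalence of two multisubsets `{A_1, …, A_m}` and `{B_1, …, B_m}` of `ℤ_p^n`. -/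
def WeaklyEquivalent {m n : ℕ} (A B : Fin m → Fin n → ℤ_[p]) : Prop :=
  ∃ c : ℝ, 0 < c ∧ ∃ σ : ℕ → Equiv.Perm (Fin m), ∀ h : ℕ, 0 < h → ∀ (i : Fin n) (j : Fin m),
    (p : ℝ) ^ h * angle (((A (σ h j) i - B j i : ℤ_[p]) : ℚ_[p]) / (p : ℚ_[p]) ^ h) ≤ c * h

end Exponents

end PFuchs

end

noncomputable section

namespace PFuchs

open Filter Topology TensorProduct

/-! ### Gauss norms: attained maxima, multiplicativity, the ultrametric inequality. -/

section GaussNorm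

/-! Let `S_k` and `T_k` be the matrices that witness the two exponents `A` and `B`, and let `U` be
the change of basis between the two models over the germ ring. The columns of `S_k` and of `U T_k`
are eigenvectors of `Γ_k^n` in the same module, with characters `A` and `B`. If `S_k` were
invertible, the entry `(i, j)` of `S_k⁻¹ U T_k` would therefore contain only monomials whose
exponents are congruent to `B_j - A_i` modulo `p^k`.

Since `S_k` need not be invertible, denominators are cleared: put `d = det S_k` and let `g` be the
entry `(i, j)` of `adj(S_k) U T_k`. Comparing `d(t) g(ζt)` with `d(ζt) g(t)` and applying Fourier
inversion in one variable at a time gives `d g_a = d_{a+δ} g`, with `δ = A_i - B_j` and subscripts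
denoting the parts in a residue class modulo `p^k` (`GammaModule.det_mul_residuePart`). The Gauss
norm at `ρ` is multiplicative (`LaurentRing.gaussNorm_mul`), so choosing `a + δ` as the class of a
dominant term of `d` forces `g` to have a dominant term in the class `a` (`exists_dominant_pair`).
Thus `δ` is represented by a difference of exponents of dominant terms.

These exponents are `O(k)`. All entries are at most exponential in `k` at `ρ` and at the radii `ρ`
rescaled by `exp (±ε)` in one direction, so a term that is at least exponentially small at `ρ` has
exponent `O(k)` in that direction (`mul_abs_exponent_le`). For `d` the lower bound is part of the
definition of an exponent. For `g` it comes from the Leibniz expansion of `det (adj(S_k) U T_k)`,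
whose norm is at least that of `det U`: some permutation picks entries with large product, and the
upper bounds make every factor large. This permutation is the one that weak equivalence asks for. -/

theorem exists_forall_le_of_tendsto_zero {ι : Type*} [Nonempty ι] {a : ι → ℝ}
    (h0 : ∀ i, 0 ≤ a i) (ha : Tendsto a cofinite (𝓝 0)) : ∃ i, ∀ j, a j ≤ a i := by
  by_cases h : ∃ i, 0 < a i
  · obtain ⟨i, hi⟩ := h
    have hfin : {j | ¬ a j < a i}.Finite := ha.eventually_lt_const hi
    obtain ⟨k, hk, hmax⟩ := hfin.exists_maximalFor a _ ⟨i, lt_irrefl (a i)⟩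
    refine ⟨k, fun j => ?_⟩
    by_cases hj : a j < a i
    · exact hj.le.trans (not_lt.1 hk)
    · exact (le_total (a j) (a k)).elim id fun hle => hmax hj hle
  · push Not at h
    exact ⟨Classical.arbitrary ι, fun j => (h j).trans (h0 _)⟩

variable {K : Type u} [NontriviallyNormedField K] {n : ℕ} {σ : Radius n}

theorem ConvergesAt.exists_max {f : (Fin n → ℤ) → K} (hf : ConvergesAt f σ) :
    ∃ i, ∀ j, ‖f j‖ * σ.mono j ≤ ‖f i‖ * σ.mono i :=
  exists_forall_le_of_tendsto_zero
    (fun i => mul_nonneg (norm_nonneg _) (σ.mono_pos i).le) hf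

theorem ConvergesAt.bddAbove {f : (Fin n → ℤ) → K} (hf : ConvergesAt f σ) :
    BddAbove (Set.range fun i => ‖f i‖ * σ.mono i) := by
  obtain ⟨i, hi⟩ := hf.exists_max
  exact ⟨_, Set.forall_mem_range.2 hi⟩

/-- A convergent sum with a strictly dominant term has the norm of that term. -/
theorem norm_tsum_eq_of_dominant [IsUltrametricDist K] {ι : Type*} {u : ι → K}
    (hu : Summable u) (i : ι)
    (h : ∀ j, j ≠ i → ‖u j‖ < ‖u i‖) : ‖∑' j, u j‖ = ‖u i‖ := by
  classical
  rw [hu.tsum_eq_add_tsum_ite i]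
  by_cases hi : ∀ j, j = i
  · have : (fun j => if j = i then 0 else u j) = fun _ => 0 := by
      funext j; simp [hi j]
    rw [this, tsum_zero, add_zero]
  push Not at hi
  obtain ⟨j₁, hj₁⟩ := hi
  have ht : Tendsto (fun j => ‖if j = i then 0 else u j‖) cofinite (𝓝 0) := by
    refine squeeze_zero (fun _ => norm_nonneg _) (fun j => ?_)
      (tendsto_zero_iff_norm_tendsto_zero.1 hu.tendsto_cofinite_zero)
    split_ifs <;> simp
  have : Nonempty ι := ⟨i⟩
  obtain ⟨k, hk⟩ := exists_forall_le_of_tendsto_zero (fun _ => norm_nonneg _) ht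
  have hlt : ‖if k = i then 0 else u k‖ < ‖u i‖ := by
    split_ifs with hki
    · rw [norm_zero]; exact (norm_nonneg _).trans_lt (h j₁ hj₁)
    · exact h k hki
  have hle : ‖∑' j, if j = i then 0 else u j‖ < ‖u i‖ :=
    (IsUltrametricDist.norm_tsum_le_of_forall_le hk).trans_lt hlt
  rw [IsUltrametricDist.norm_add_eq_max_of_norm_ne_norm hle.ne', max_eq_left hle.le]

variable {𝓕 : Filter (Radius n)} [NeBot 𝓕] [IsUltrametricDist K] [CompleteSpace K]

theorem LaurentRing.le_gaussNorm {f : LaurentRing K 𝓕} (hf : ConvergesAt f.1 σ)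
    (i : Fin n → ℤ) : ‖f.1 i‖ * σ.mono i ≤ f.gaussNorm σ :=
  le_ciSup (f := fun i => ‖f.1 i‖ * σ.mono i) hf.bddAbove i

theorem LaurentRing.gaussNorm_le {f : LaurentRing K 𝓕} {c : ℝ}
    (h : ∀ i, ‖f.1 i‖ * σ.mono i ≤ c) : f.gaussNorm σ ≤ c :=
  ciSup_le h

theorem LaurentRing.exists_eq_gaussNorm {f : LaurentRing K 𝓕} (hf : ConvergesAt f.1 σ) :
    ∃ i, ‖f.1 i‖ * σ.mono i = f.gaussNorm σ := by
  obtain ⟨i, hi⟩ := hf.exists_max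
  exact ⟨i, le_antisymm (le_gaussNorm hf i) (gaussNorm_le hi)⟩

theorem LaurentRing.gaussNorm_nonneg (f : LaurentRing K 𝓕) : 0 ≤ f.gaussNorm σ :=
  Real.iSup_nonneg fun i => mul_nonneg (norm_nonneg _) (σ.mono_pos i).le

theorem LaurentRing.gaussNorm_zero : (0 : LaurentRing K 𝓕).gaussNorm σ = 0 := by
  change (⨆ i, ‖(0 : K)‖ * σ.mono i) = 0
  simp

theorem LaurentRing.gaussNorm_pos {f : LaurentRing K 𝓕} (hf : ConvergesAt f.1 σ)
    (hne : f.1 ≠ 0) : 0 < f.gaussNorm σ := by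
  obtain ⟨i, hi⟩ := Function.ne_iff.1 hne
  exact (mul_pos (norm_pos_iff.2 hi) (σ.mono_pos i)).trans_le (le_gaussNorm hf i)

/-- A nonzero convergent series has a lexicographically smallest index among those of the terms
that attain the Gauss norm. -/
theorem LaurentRing.exists_lexMin {f : LaurentRing K 𝓕} (hf : ConvergesAt f.1 σ)
    (hne : f.1 ≠ 0) : ∃ i, ‖f.1 i‖ * σ.mono i = f.gaussNorm σ ∧
      ∀ j, ‖f.1 j‖ * σ.mono j = f.gaussNorm σ → toLex i ≤ toLex j := by
  have hfin : {j | ‖f.1 j‖ * σ.mono j = f.gaussNorm σ}.Finite := by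
    refine Set.Finite.subset (hf.eventually_lt_const (gaussNorm_pos hf hne)) fun j hj => ?_
    exact fun hlt => hlt.ne hj
  obtain ⟨i, hi, hmin⟩ := hfin.exists_minimalFor toLex _ (exists_eq_gaussNorm hf)
  exact ⟨i, hi, fun j hj => (le_total (toLex i) (toLex j)).elim id fun hle => hmin hj hle⟩

/-- Gauss's lemma. The lexicographically smallest dominant exponents `i` of `f` and `j` of `g` give
a product of terms that strictly dominates every other contribution to the coefficient of index `i +
j`, so nothing cancels there. -/
theorem LaurentRing.gaussNorm_mul {f g : LaurentRing K 𝓕} (hf : ConvergesAt f.1 σ)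
    (hg : ConvergesAt g.1 σ) : (f * g).gaussNorm σ = f.gaussNorm σ * g.gaussNorm σ := by
  have hfg : ConvergesAt (f * g).1 σ := hf.convol hg
  have key : ∀ i j, ‖f.1 j * g.1 (i - j)‖ * σ.mono i =
      (‖f.1 j‖ * σ.mono j) * (‖g.1 (i - j)‖ * σ.mono (i - j)) := fun i j => by
    have : σ.mono i = σ.mono j * σ.mono (i - j) := by rw [← Radius.mono_add]; congr 1; abel
    rw [this, norm_mul]; ring
  refine le_antisymm (gaussNorm_le fun i => ?_) ?_
  · rw [← le_div_iff₀ (σ.mono_pos i)]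
    refine IsUltrametricDist.norm_tsum_le_of_forall_le fun j => ?_
    rw [le_div_iff₀ (σ.mono_pos i), key]
    exact mul_le_mul (le_gaussNorm hf _) (le_gaussNorm hg _)
      (mul_nonneg (norm_nonneg _) (σ.mono_pos _).le) (gaussNorm_nonneg f)
  by_cases hf0 : f.1 = 0
  · rw [show f = 0 from LaurentRing.ext hf0, zero_mul]
    rw [gaussNorm_zero, zero_mul]
  by_cases hg0 : g.1 = 0
  · rw [show g = 0 from LaurentRing.ext hg0, mul_zero]
    rw [gaussNorm_zero, mul_zero]
  obtain ⟨i, hi, himin⟩ := exists_lexMin hf hf0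
  obtain ⟨j, hj, hjmin⟩ := exists_lexMin hg hg0
  refine le_trans (le_of_eq ?_) (le_gaussNorm hfg (i + j))
  have hdom : ‖∑' l, f.1 l * g.1 (i + j - l)‖ = ‖f.1 i * g.1 (i + j - i)‖ := by
    refine norm_tsum_eq_of_dominant (hf.summable_convol hg _) i fun l hl => ?_
    rw [← mul_lt_mul_iff_of_pos_right (σ.mono_pos (i + j)), key, key, add_sub_cancel_left, hi, hj]
    have h1 := le_gaussNorm hf l
    have h2 := le_gaussNorm hg (i + j - l)
    have hfp := gaussNorm_pos hf hf0
    have hgp := gaussNorm_pos hg hg0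
    rcases h1.lt_or_eq with h1' | h1'
    · exact (mul_le_mul_of_nonneg_left h2 (mul_nonneg (norm_nonneg _) (σ.mono_pos _).le)).trans_lt
        (mul_lt_mul_of_pos_right h1' hgp)
    rcases h2.lt_or_eq with h2' | h2'
    · rw [h1']; exact mul_lt_mul_of_pos_left h2' hfp
    -- Both factors are dominant, so minimality gives `i < l` and `j ≤ i + j - l` lexicographically;
    -- adding these yields `i + j < i + j`.
    exfalso
    have h3 := himin _ h1'
    have h4 := hjmin _ h2'
    have h5 : toLex i < toLex l := lt_of_le_of_ne h3 fun h => hl (toLex.injective h).symm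
    have h6 := add_lt_add_of_lt_of_le h5 h4
    rw [← toLex_add, ← toLex_add, add_sub_cancel] at h6
    exact lt_irrefl _ h6
  change _ = ‖∑' l, f.1 l * g.1 (i + j - l)‖ * _
  rw [hdom, key, hi, add_sub_cancel_left, hj]

instance : Nontrivial (LaurentRing K 𝓕) := ⟨1, 0, fun h => by
  have h0 : (Pi.single (0 : Fin n → ℤ) (1 : K) : (Fin n → ℤ) → K) 0 = 0 :=
    congrFun (congrArg Subtype.val h) 0
  simp at h0⟩

/-- At a single radius every element has a Gauss norm that detects zero, so determinants can be
estimated through a genuine absolute value. -/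
instance : IsDomain (LaurentRing K (pure σ)) := by
  have : NoZeroDivisors (LaurentRing K (pure σ)) := ⟨fun {f g} h => by
    by_contra! hne
    have hf := LaurentRing.gaussNorm_pos f.2 fun h0 => hne.1 (LaurentRing.ext h0)
    have hg := LaurentRing.gaussNorm_pos g.2 fun h0 => hne.2 (LaurentRing.ext h0)
    have hfg := LaurentRing.gaussNorm_mul (σ := σ) f.2 g.2
    rw [h, LaurentRing.gaussNorm_zero] at hfg
    exact (mul_pos hf hg).ne hfg⟩
  exact NoZeroDivisors.to_isDomain _

/-- The Gauss norm on the ring of Laurent series that converge at `σ`. -/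
def gaussAbv (σ : Radius n) : AbsoluteValue (LaurentRing K (pure σ)) ℝ where
  toFun := LaurentRing.gaussNorm σ
  map_mul' f g := LaurentRing.gaussNorm_mul f.2 g.2
  nonneg' f := f.gaussNorm_nonneg
  eq_zero' f := by
    refine ⟨fun h => by_contra fun hne => ?_, fun h => ?_⟩
    · exact (LaurentRing.gaussNorm_pos f.2 fun h0 => hne (LaurentRing.ext h0)).ne' h
    · subst h
      exact LaurentRing.gaussNorm_zero
  add_le' f g := LaurentRing.gaussNorm_le fun i => by
    refine (mul_le_mul_of_nonneg_right (norm_add_le (f.1 i) (g.1 i)) (σ.mono_pos i).le).trans ?_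
    rw [add_mul]
    exact add_le_add (LaurentRing.le_gaussNorm f.2 i) (LaurentRing.le_gaussNorm g.2 i)

theorem gaussAbv_isNonarchimedean (σ : Radius n) :
    IsNonarchimedean (gaussAbv (K := K) σ) := fun f g =>
  LaurentRing.gaussNorm_le (f := f + g) fun i => by
    refine (mul_le_mul_of_nonneg_right (IsUltrametricDist.norm_add_le_max (f.1 i) (g.1 i))
      (σ.mono_pos i).le).trans ?_
    rw [max_mul_of_nonneg _ _ (σ.mono_pos i).le]
    exact max_le_max (LaurentRing.le_gaussNorm f.2 i) (LaurentRing.le_gaussNorm g.2 i)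

end GaussNorm

/-! ### Determinants and adjugates under a nonarchimedean absolute value. -/

section Ultrametric

variable {R : Type*} [CommRing R] {v : AbsoluteValue R ℝ}

theorem abv_sum_le (hv : IsNonarchimedean v) {ι : Type*} (s : Finset ι) (f : ι → R) {c : ℝ}
    (hc : 0 ≤ c)
    (h : ∀ i ∈ s, v (f i) ≤ c) : v (∑ i ∈ s, f i) ≤ c := by
  classical
  induction s using Finset.induction_on with
  | empty => simpa using hc
  | insert a s ha ih =>
    rw [Finset.sum_insert ha]
    exact (hv _ _).trans (max_le (h a (Finset.mem_insert_self a s))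
      (ih fun i hi => h i (Finset.mem_insert_of_mem hi)))

theorem abv_mul_le (hv : IsNonarchimedean v) {m : ℕ} {M N : Matrix (Fin m) (Fin m) R} {c d : ℝ}
    (hc : 0 ≤ c) (hd : 0 ≤ d)
    (hM : ∀ i j, v (M i j) ≤ c) (hN : ∀ i j, v (N i j) ≤ d) (i j : Fin m) :
    v ((M * N) i j) ≤ c * d := by
  rw [Matrix.mul_apply]
  refine abv_sum_le hv _ _ (mul_nonneg hc hd) fun l _ => ?_
  rw [map_mul]
  exact mul_le_mul (hM i l) (hN l j) (v.nonneg _) hc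

variable [IsDomain R]

/-- The ultrametric inequality bounds the Leibniz sum by its largest term; `s` is a permutation
attaining it. -/
theorem exists_perm_abv_det_le (hv : IsNonarchimedean v) {m : ℕ} (M : Matrix (Fin m) (Fin m) R) :
    ∃ s : Equiv.Perm (Fin m), v M.det ≤ ∏ j, v (M (s j) j) := by
  obtain ⟨s, -, hs⟩ := Finset.exists_max_image Finset.univ
    (fun s : Equiv.Perm (Fin m) => ∏ j, v (M (s j) j)) Finset.univ_nonempty
  refine ⟨s, ?_⟩
  rw [Matrix.det_apply']
  refine abv_sum_le hv _ _ (Finset.prod_nonneg fun j _ => v.nonneg _) fun t ht => ?_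
  rw [map_mul, map_prod]
  have : v ((Equiv.Perm.sign t : ℤ) : R) ≤ 1 := by
    rcases Int.units_eq_one_or (Equiv.Perm.sign t) with h | h <;> simp [h]
  exact (mul_le_of_le_one_left (Finset.prod_nonneg fun j _ => v.nonneg _) this).trans (hs t ht)

theorem abv_det_le (hv : IsNonarchimedean v) {m : ℕ} {M : Matrix (Fin m) (Fin m) R} {c : ℝ}
    (h : ∀ i j, v (M i j) ≤ c) : v M.det ≤ c ^ m := by
  obtain ⟨s, hs⟩ := exists_perm_abv_det_le hv M
  refine hs.trans ((Finset.prod_le_prod (fun j _ => v.nonneg _) fun j _ => h (s j) j).trans ?_)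
  simp

theorem abv_adjugate_le (hv : IsNonarchimedean v) {m : ℕ} {M : Matrix (Fin m) (Fin m) R} {c : ℝ}
    (hc : 1 ≤ c)
    (h : ∀ i j, v (M i j) ≤ c) (i j : Fin m) : v (M.adjugate i j) ≤ c ^ m := by
  rw [Matrix.adjugate_apply]
  refine abv_det_le hv fun a b => ?_
  rw [Matrix.updateRow_apply]
  split_ifs
  · rw [Pi.single_apply]
    split_ifs
    · simpa using hc
    · simpa using zero_le_one.trans hc
  · exact h a b

end Ultrametric

/-! ### Splitting by residue classes of exponents, and Fourier inversion. -/

section Residue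

variable {K : Type u} [NontriviallyNormedField K] [CompleteSpace K] [IsUltrametricDist K]
  {n : ℕ} {𝓕 : Filter (Radius n)} [NeBot 𝓕] {N : ℕ}

/-- The part of a Laurent series whose exponents have `r`-th entry in the residue class `a`. -/
def residuePart (r : Fin n) (a : ZMod N) : LaurentRing K 𝓕 →ₗ[K] LaurentRing K 𝓕 :=
  LaurentRing.part {i | ((i r : ℤ) : ZMod N) = a}

theorem residuePart_apply_of_eq {r : Fin n} {a : ZMod N} (f : LaurentRing K 𝓕) {i : Fin n → ℤ}
    (h : ((i r : ℤ) : ZMod N) = a) : (residuePart r a f).1 i = f.1 i :=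
  if_pos (c := i ∈ {i : Fin n → ℤ | ((i r : ℤ) : ZMod N) = a}) h

theorem residuePart_apply_of_ne {r : Fin n} {a : ZMod N} (f : LaurentRing K 𝓕) {i : Fin n → ℤ}
    (h : ((i r : ℤ) : ZMod N) ≠ a) : (residuePart r a f).1 i = 0 :=
  if_neg (c := i ∈ {i : Fin n → ℤ | ((i r : ℤ) : ZMod N) = a}) h

/-- Residue classes of the `r`-th exponent grade the ring by `ZMod N`. This is what makes `dilate`
multiplicative. -/
theorem residuePart_mul (r : Fin n) (a b : ZMod N) (f g : LaurentRing K 𝓕) :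
    residuePart r a (residuePart r b f * g) = residuePart r b f * residuePart r (a - b) g := by
  refine LaurentRing.ext (funext fun i => ?_)
  have key : ∀ j, (residuePart r b f).1 j * (residuePart r (a - b) g).1 (i - j) =
      if ((i r : ℤ) : ZMod N) = a then (residuePart r b f).1 j * g.1 (i - j) else 0 := by
    intro j
    by_cases hj : ((j r : ℤ) : ZMod N) = b
    · split_ifs with hi
      · rw [residuePart_apply_of_eq g]
        simp [hi, hj]
      · rw [residuePart_apply_of_ne g, mul_zero]
        simpa [hj] using hi
    · rw [residuePart_apply_of_ne f hj, zero_mul, zero_mul, ite_self]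
  change _ = ∑' j, _
  simp_rw [key]
  by_cases hi : ((i r : ℤ) : ZMod N) = a
  · rw [residuePart_apply_of_eq _ hi]
    simp only [hi, if_true]
    rfl
  · rw [residuePart_apply_of_ne _ hi]
    simp [hi]

theorem coeff_sum {ι : Type*} (s : Finset ι) (f : ι → LaurentRing K 𝓕) (i : Fin n → ℤ) :
    (∑ a ∈ s, f a).1 i = ∑ a ∈ s, (f a).1 i :=
  map_sum (LaurentRing.coeff i) f s

theorem sum_residuePart [NeZero N] (r : Fin n) (f : LaurentRing K 𝓕) :
    ∑ a : ZMod N, residuePart r a f = f := by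
  refine LaurentRing.ext (funext fun i => ?_)
  rw [coeff_sum, Finset.sum_eq_single ((i r : ℤ) : ZMod N)]
  · exact residuePart_apply_of_eq f rfl
  · exact fun a _ ha => residuePart_apply_of_ne f ha.symm
  · simp

theorem residuePart_algebraMap (r : Fin n) (a : ZMod N) (c : K) :
    residuePart r a (algebraMap K (LaurentRing K 𝓕) c) =
      if a = 0 then algebraMap K (LaurentRing K 𝓕) c else 0 := by
  refine LaurentRing.ext (funext fun i => ?_)
  by_cases hi : i = 0
  · subst hi
    split_ifs with ha
    · exact residuePart_apply_of_eq _ (by simp [ha])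
    · exact residuePart_apply_of_ne _ (by simpa using fun h => ha h.symm)
  · have h0 : (algebraMap K (LaurentRing K 𝓕) c).1 i = 0 :=
      Pi.single_eq_of_ne (M := fun _ => K) hi c
    have h1 : (residuePart r a (algebraMap K (LaurentRing K 𝓕) c)).1 i = 0 := by
      by_cases h : ((i r : ℤ) : ZMod N) = a
      · rw [residuePart_apply_of_eq _ h, h0]
      · exact residuePart_apply_of_ne _ h
    rw [h1]
    split_ifs
    · exact h0.symm
    · rfl

variable {L : Type*} [CommRing L] [Algebra K L]

theorem pow_zmod_val_add [NeZero N] {z : L} (hz : z ^ N = 1) (a b : ZMod N) :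
    z ^ (a + b).val = z ^ a.val * z ^ b.val := by
  rw [ZMod.val_add, ← pow_add]
  exact (pow_eq_pow_mod _ hz).symm

/-- The dilation `f(t) ↦ f(t_1, …, z t_r, …, t_n)` for an `N`-th root of unity `z`. -/
def dilate [NeZero N] (r : Fin n) (z : L) (hz : z ^ N = 1) :
    LaurentRing K 𝓕 →+* LaurentRing K 𝓕 ⊗[K] L where
  toFun f := ∑ a : ZMod N, residuePart r a f ⊗ₜ[K] (z ^ a.val)
  map_zero' := by simp
  map_add' f g := by simp [add_tmul, Finset.sum_add_distrib]
  map_one' := by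
    have := fun a : ZMod N => residuePart_algebraMap (𝓕 := 𝓕) r a (1 : K)
    simp only [map_one] at this
    rw [Finset.sum_eq_single 0]
    · rw [this, if_pos rfl, ZMod.val_zero, pow_zero]; rfl
    · intro a _ ha
      rw [this, if_neg ha, zero_tmul]
    · simp
  map_mul' f g := by
    have h1 : ∀ a : ZMod N, residuePart r a (f * g) =
        ∑ b : ZMod N, residuePart r b f * residuePart r (a - b) g := fun a => by
      conv_lhs => rw [← sum_residuePart (N := N) r f, Finset.sum_mul, map_sum]
      exact Finset.sum_congr rfl fun b _ => residuePart_mul r a b f g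
    simp_rw [h1, sum_tmul, Finset.sum_mul_sum, Algebra.TensorProduct.tmul_mul_tmul]
    rw [Finset.sum_comm]
    refine Finset.sum_congr rfl fun b _ => ?_
    rw [← Equiv.sum_comp (Equiv.addLeft b)]
    refine Finset.sum_congr rfl fun c _ => ?_
    rw [Equiv.coe_addLeft, add_sub_cancel_left, pow_zmod_val_add hz]

theorem dilate_apply [NeZero N] (r : Fin n) (z : L) (hz : z ^ N = 1) (f : LaurentRing K 𝓕) :
    dilate r z hz f = ∑ a : ZMod N, residuePart r a f ⊗ₜ[K] (z ^ a.val) := rfl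

/-- If a family of Laurent series indexed by residue classes has vanishing discrete Fourier
transform, it vanishes. -/
theorem eq_zero_of_sum_tmul_pow_eq_zero [NeZero N] {L : Type*} [Field L] [Algebra K L] {z : L}
    (hz : IsPrimitiveRoot z N) (F : ZMod N → LaurentRing K 𝓕)
    (h : ∀ t : ℕ, ∑ c, F c ⊗ₜ[K] ((z ^ t) ^ c.val) = (0 : LaurentRing K 𝓕 ⊗[K] L)) (c : ZMod N) :
    F c = 0 := by
  refine LaurentRing.ext (funext fun i => ?_)
  have hinj : Function.Injective fun c : ZMod N => powersHom L (z ^ c.val) := by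
    intro a b hab
    have h1 := DFunLike.congr_fun hab (Multiplicative.ofAdd 1)
    simp only [powersHom_apply, toAdd_ofAdd, pow_one] at h1
    exact ZMod.val_injective N (hz.pow_inj (ZMod.val_lt a) (ZMod.val_lt b) h1)
  -- Dedekind's independence of characters, applied to the `N` distinct characters `t ↦ z^(c t)` of
  -- `ℕ`, replaces an explicit inversion formula.
  have hli := (linearIndependent_monoidHom (Multiplicative ℕ) L).comp _ hinj
  have hsum : ∑ c, algebraMap K L ((F c).1 i) •
      ((fun f : Multiplicative ℕ →* L => (f : Multiplicative ℕ → L)) ∘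
        fun c : ZMod N => powersHom L (z ^ c.val)) c = 0 := by
    funext t
    have h1 := congrArg (fun x => TensorProduct.lid K L
      (LinearMap.rTensor L (LaurentRing.coeff (K := K) (𝓕 := 𝓕) i) x)) (h t.toAdd)
    simp only [map_sum, LinearMap.rTensor_tmul, TensorProduct.lid_tmul, map_zero] at h1
    rw [Finset.sum_apply, Pi.zero_apply, ← h1]
    refine Finset.sum_congr rfl fun c _ => ?_
    rw [Pi.smul_apply, Function.comp_apply, powersHom_apply, smul_eq_mul,
      ← pow_mul, ← pow_mul, mul_comm c.val, Algebra.smul_def]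
    rfl
  exact (map_eq_zero_iff _ (algebraMap K L).injective).1
    (Fintype.linearIndependent_iff.1 hli _ hsum c)

end Residue

/-! ### The action of a root of unity in one variable, as a ring homomorphism. -/

section Twist

variable {K : Type u} [NontriviallyNormedField K] {p : ℕ} {n : ℕ}

/-- The element of `Γ^n` with `r`-th entry `z` and all other entries `1`. -/
def GammaPow.single (r : Fin n) (z : (KGamma K p)ˣ) {k : ℕ} (hz : z ^ p ^ k = 1) :
    GammaPow K p n :=
  ⟨Pi.mulSingle r z, k, fun s => by
    rcases eq_or_ne s r with rfl | h
    · rw [Pi.mulSingle_eq_same, hz]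
    · rw [Pi.mulSingle_eq_of_ne h, one_pow]⟩

theorem GammaPow.single_same (r : Fin n) (z : (KGamma K p)ˣ) {k : ℕ} (hz : z ^ p ^ k = 1) :
    (GammaPow.single r z hz).1 r = z :=
  Pi.mulSingle_eq_same (M := fun _ => (KGamma K p)ˣ) r z

theorem GammaPow.single_of_ne {r s : Fin n} (h : s ≠ r) (z : (KGamma K p)ˣ) {k : ℕ}
    (hz : z ^ p ^ k = 1) : (GammaPow.single r z hz).1 s = 1 :=
  Pi.mulSingle_eq_of_ne (M := fun _ => (KGamma K p)ˣ) h z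

theorem GammaPow.single_inLevel (r : Fin n) (z : (KGamma K p)ˣ) {k : ℕ} (hz : z ^ p ^ k = 1) :
    GammaPow.InLevel (GammaPow.single r z hz) k := fun s => by
  rcases eq_or_ne s r with rfl | h
  · rw [single_same, hz]
  · rw [single_of_ne h, one_pow]

theorem GammaPow.padicPow_single [Fact p.Prime] (r : Fin n) (z : (KGamma K p)ˣ) {k : ℕ}
    (hz : z ^ p ^ k = 1) (a : Fin n → ℤ_[p]) : GammaPow.padicPow (GammaPow.single r z hz) k a =
      (z : KGamma K p) ^ (PadicInt.toZModPow k (a r)).val := by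
  rw [padicPow, Finset.prod_eq_single r]
  · rw [single_same]
  · intro s _ hs
    rw [single_of_ne hs, Units.val_one, one_pow]
  · simp

variable [CompleteSpace K] [IsUltrametricDist K] {𝓕 : Filter (Radius n)} [NeBot 𝓕]

/-- A `K`-basis of `K(Γ)` turns an element of the tensor product into a finitely supported family of
Laurent series, whose `i`-th coefficients are the coordinates of `coeff i`. -/
theorem LaurentRingGamma.ext_coeff {x y : LaurentRingGamma 𝓕 K p}
    (h : ∀ i, coeff i x = coeff i y) : x = y := by
  let b := Module.Free.chooseBasis K (KGamma K p)
  let φ := TensorProduct.equivFinsuppOfBasisRight (M := LaurentRing K 𝓕) b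
  have key : ∀ (x : LaurentRingGamma 𝓕 K p) i j, (φ x j).1 i = b.repr (coeff i x) j := by
    intro x i j
    induction x using TensorProduct.induction_on with
    | zero => simp; rfl
    | add x y hx hy =>
      rw [map_add, map_add, map_add, Finsupp.add_apply, Finsupp.add_apply, ← hx, ← hy]; rfl
    | tmul f c =>
      rw [TensorProduct.equivFinsuppOfBasisRight_apply_tmul_apply]
      simp only [coeff, LinearMap.comp_apply, LinearMap.rTensor_tmul, LinearEquiv.coe_coe,
        TensorProduct.lid_tmul, map_smul, Finsupp.smul_apply, smul_eq_mul]
      rw [mul_comm]; rfl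
  refine φ.injective (Finsupp.ext fun j => LaurentRing.ext (funext fun i => ?_))
  rw [key, key, h]

variable [Fact p.Prime]

/-- Connects the action, defined only as a linear map, with `dilate`, which is known to be a ring
homomorphism and so can be applied to matrix products and determinants. -/
theorem LaurentRingGamma.twist_single (r : Fin n) (z : (KGamma K p)ˣ) {k : ℕ}
    (hz : z ^ p ^ k = 1) (hz' : (z : KGamma K p) ^ p ^ k = 1) (f : LaurentRing K 𝓕) :
    twist (GammaPow.single r z hz) (f ⊗ₜ[K] 1) = dilate r (z : KGamma K p) hz' f := by
  refine ext_coeff fun i => ?_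
  rw [coeff_twist, dilate_apply, map_sum]
  simp only [coeff, LinearMap.comp_apply, LinearMap.rTensor_tmul, LinearEquiv.coe_coe,
        TensorProduct.lid_tmul]
  rw [Finset.sum_eq_single ((i r : ℤ) : ZMod (p ^ k))]
  · have h1 : LaurentRing.coeff i (residuePart r ((i r : ℤ) : ZMod (p ^ k)) f) =
        LaurentRing.coeff i f := residuePart_apply_of_eq f rfl
    rw [h1, mul_smul_comm, mul_one, Finset.prod_eq_single r]
    · congr 1
      rw [GammaPow.single_same, ← Units.val_pow_eq_pow_val, ← zpow_natCast,
        ZMod.val_intCast]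
      congr 1
      conv_lhs => rw [← Int.emod_add_mul_ediv (i r) ((p ^ k : ℕ) : ℤ)]
      rw [zpow_add, zpow_mul, zpow_natCast z (p ^ k), hz, one_zpow, mul_one]
    · intro s _ hs
      rw [GammaPow.single_of_ne hs, one_zpow]
    · simp
  · intro a _ ha
    have h1 : LaurentRing.coeff i (residuePart r a f) = 0 := residuePart_apply_of_ne f ha.symm
    rw [h1, zero_smul]
  · simp

end Twist

/-- Eliminating `E` gives, when `S` is invertible, `α · τ(S⁻¹W) = ι(S⁻¹W) · β` with diagonal `α`,
`β`. Replacing `S⁻¹` by the adjugate costs a factor `det S` under `ι` on one side and under `τ` on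
the other. -/
theorem det_mul_adjugate_mul_of_intertwine {R Q : Type*} [CommRing R] [CommRing Q] (ι τ : R →+* Q)
    {m : ℕ} {S W : Matrix (Fin m) (Fin m) R} {E : Matrix (Fin m) (Fin m) Q} {α β : Fin m → Q}
    (hS : E * S.map τ = S.map ι * Matrix.diagonal α)
    (hW : E * W.map τ = W.map ι * Matrix.diagonal β) (i j : Fin m) :
    ι S.det * α i * τ ((S.adjugate * W) i j) = τ S.det * (ι ((S.adjugate * W) i j) * β j) := by
  have hadj : ∀ φ : R →+* Q,
      S.map φ * S.adjugate.map φ = φ S.det • 1 ∧ S.adjugate.map φ * S.map φ = φ S.det • 1 := by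
    intro φ
    have hm : S.adjugate.map φ = (S.map φ).adjugate := φ.map_adjugate S
    have hd : φ S.det = (S.map φ).det := φ.map_det S
    rw [hm, hd]
    exact ⟨Matrix.mul_adjugate _, Matrix.adjugate_mul _⟩
  have h : ι S.det • (Matrix.diagonal α * (S.adjugate * W).map τ) =
      τ S.det • ((S.adjugate * W).map ι * Matrix.diagonal β) := by
    calc ι S.det • (Matrix.diagonal α * (S.adjugate * W).map τ)
        = (ι S.det • 1) * Matrix.diagonal α * S.adjugate.map τ * W.map τ := by
          rw [Matrix.map_mul, smul_mul_assoc, smul_mul_assoc, smul_mul_assoc, one_mul,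
            Matrix.mul_assoc]
      _ = S.adjugate.map ι * (S.map ι * Matrix.diagonal α) * S.adjugate.map τ * W.map τ := by
          rw [← (hadj ι).2]; simp only [Matrix.mul_assoc]
      _ = S.adjugate.map ι * E * (S.map τ * S.adjugate.map τ) * W.map τ := by
          rw [← hS]; simp only [Matrix.mul_assoc]
      _ = τ S.det • (S.adjugate.map ι * (E * W.map τ)) := by
          rw [(hadj τ).1, mul_smul_comm, smul_mul_assoc, mul_one, Matrix.mul_assoc]
      _ = _ := by rw [hW, Matrix.map_mul, Matrix.mul_assoc]
  have h' := congrFun (congrFun h i) j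
  rwa [Matrix.smul_apply, Matrix.smul_apply, Matrix.diagonal_mul, Matrix.mul_diagonal,
    Matrix.map_apply, Matrix.map_apply, smul_eq_mul, smul_eq_mul, ← mul_assoc] at h'

theorem exists_isPrimitiveRoot_kGamma {K : Type u} [NontriviallyNormedField K] {p : ℕ}
    [Fact p.Prime] (hp : (p : K) ≠ 0) (k : ℕ) :
    ∃ z : KGamma K p, IsPrimitiveRoot z (p ^ k) := by
  have : NeZero ((p ^ k : ℕ) : AlgebraicClosure K) := ⟨by
    have h := (map_ne_zero (algebraMap K (AlgebraicClosure K))).2 (pow_ne_zero k hp)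
    simpa using h⟩
  obtain ⟨z, hz⟩ := HasEnoughRootsOfUnity.exists_primitiveRoot (AlgebraicClosure K) (p ^ k)
  have hmem : z ∈ KGamma K p := IntermediateField.subset_adjoin K _ ⟨k, hz.pow_eq_one⟩
  exact ⟨⟨z, hmem⟩, IsPrimitiveRoot.of_map_of_injective (f := (KGamma K p).val) hz
    (KGamma K p).val.injective⟩

/-! ### From eigenvectors to a relation between residue parts. -/

section Relation

variable {K : Type u} [NontriviallyNormedField K] [CompleteSpace K] [IsUltrametricDist K]
  {p : ℕ} {n : ℕ} {𝓕 : Filter (Radius n)} [NeBot 𝓕]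

theorem scalarAction_tmul (P : Type v) [AddCommGroup P] [Module K P]
    [Module (LaurentRing K 𝓕) P] [IsScalarTower K (LaurentRing K 𝓕) P]
    (f : LaurentRing K 𝓕) (c d : KGamma K p) (x : P) :
    scalarAction K p 𝓕 P (f ⊗ₜ[K] c) (x ⊗ₜ[K] d) = (f • x) ⊗ₜ[K] (c * d) := rfl

theorem rTensor_scalarAction (P : Type v) [AddCommGroup P] [Module K P]
    [Module (LaurentRing K 𝓕) P] [IsScalarTower K (LaurentRing K 𝓕) P]
    (φ : P →ₗ[LaurentRing K 𝓕] LaurentRing K 𝓕) (c : LaurentRingGamma 𝓕 K p)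
    (x : P ⊗[K] KGamma K p) :
    LinearMap.rTensor (KGamma K p) (φ.restrictScalars K) (scalarAction K p 𝓕 P c x) =
      c * LinearMap.rTensor (KGamma K p) (φ.restrictScalars K) x := by
  induction c using TensorProduct.induction_on with
  | zero => simp
  | add a b ha hb => rw [map_add, LinearMap.add_apply, map_add, ha, hb, add_mul]
  | tmul f c =>
    induction x using TensorProduct.induction_on with
    | zero => simp
    | add a b ha hb => rw [map_add, map_add, map_add, ha, hb, mul_add]
    | tmul x d =>
      rw [scalarAction_tmul, LinearMap.rTensor_tmul, LinearMap.rTensor_tmul,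
        Algebra.TensorProduct.tmul_mul_tmul, LinearMap.restrictScalars_apply,
        LinearMap.restrictScalars_apply, map_smul, smul_eq_mul]

/-- Take coordinates in the eigenvector equation: semilinearity replaces each coefficient `S i j` by
its twist `τ (S i j)`. -/
theorem GammaModule.reprMatrix_mul_map (P : GammaModule.{u, v} K p 𝓕) {m : ℕ}
    (e : Module.Basis (Fin m) (LaurentRing K 𝓕) P.carrier) (ζ : GammaPow K p n)
    (τ : LaurentRing K 𝓕 →+* LaurentRingGamma 𝓕 K p)
    (hτ : ∀ f, LaurentRingGamma.twist ζ (f ⊗ₜ[K] 1) = τ f)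
    (S : Matrix (Fin m) (Fin m) (LaurentRing K 𝓕)) (α : Fin m → KGamma K p)
    (hS : ∀ j, P.act ζ ((∑ i, S i j • e i) ⊗ₜ[K] 1) = (∑ i, S i j • e i) ⊗ₜ[K] α j) :
    P.reprMatrix e ζ * S.map τ =
      S.map (Algebra.TensorProduct.includeLeftRingHom : _ →+* LaurentRingGamma 𝓕 K p) *
        Matrix.diagonal fun j => (1 : LaurentRing K 𝓕) ⊗ₜ[K] α j := by
  ext l j
  have h := congrArg (LinearMap.rTensor (KGamma K p) ((e.coord l).restrictScalars K)) (hS j)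
  rw [sum_tmul, map_sum, map_sum, LinearMap.rTensor_tmul, LinearMap.restrictScalars_apply,
    map_sum] at h
  have h1 : ∀ i, P.act ζ ((S i j • e i) ⊗ₜ[K] 1) =
      scalarAction K p 𝓕 P.carrier (τ (S i j)) (P.act ζ (e i ⊗ₜ[K] 1)) := fun i => by
    rw [← hτ, ← P.semilinear, scalarAction_tmul, one_mul]
  simp_rw [h1, rTensor_scalarAction] at h
  have h2 : ∑ i, e.coord l (S i j • e i) = S l j := by
    simp [Finsupp.single_apply]
  rw [h2] at h
  rw [Matrix.mul_apply, Matrix.mul_diagonal, Matrix.map_apply,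
    Algebra.TensorProduct.includeLeftRingHom_apply, Algebra.TensorProduct.tmul_mul_tmul, mul_one,
    one_mul, ← h]
  exact Finset.sum_congr rfl fun i _ => mul_comm (P.reprMatrix e ζ l i) (τ (S i j))

theorem GammaModule.det_mul_adjugate_mul (P : GammaModule.{u, v} K p 𝓕) {m : ℕ}
    (e : Module.Basis (Fin m) (LaurentRing K 𝓕) P.carrier) (ζ : GammaPow K p n)
    (τ : LaurentRing K 𝓕 →+* LaurentRingGamma 𝓕 K p)
    (hτ : ∀ f, LaurentRingGamma.twist ζ (f ⊗ₜ[K] 1) = τ f)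
    (S W : Matrix (Fin m) (Fin m) (LaurentRing K 𝓕)) (α β : Fin m → KGamma K p)
    (hS : ∀ j, P.act ζ ((∑ i, S i j • e i) ⊗ₜ[K] 1) = (∑ i, S i j • e i) ⊗ₜ[K] α j)
    (hW : ∀ j, P.act ζ ((∑ i, W i j • e i) ⊗ₜ[K] 1) = (∑ i, W i j • e i) ⊗ₜ[K] β j)
    (i j : Fin m) :
    S.det ⊗ₜ[K] α i * τ ((S.adjugate * W) i j) =
      τ S.det * ((S.adjugate * W) i j ⊗ₜ[K] β j) := by
  have h := det_mul_adjugate_mul_of_intertwine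
    (Algebra.TensorProduct.includeLeftRingHom : _ →+* LaurentRingGamma 𝓕 K p) τ
    (P.reprMatrix_mul_map e ζ τ hτ S α hS) (P.reprMatrix_mul_map e ζ τ hτ W β hW) i j
  rw [Algebra.TensorProduct.includeLeftRingHom_apply, Algebra.TensorProduct.tmul_mul_tmul,
    Algebra.TensorProduct.includeLeftRingHom_apply, Algebra.TensorProduct.tmul_mul_tmul,
    mul_one, one_mul, mul_one, one_mul] at h
  exact h

/-- `x ∈ P` is an eigenvector of `ζ` for all `ζ ∈ Γ_k^n`, with character `ζ ↦ ζ^a`. -/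
def GammaModule.IsEigen [Fact p.Prime] (P : GammaModule.{u, v} K p 𝓕) (k : ℕ)
    (a : Fin n → ℤ_[p]) (x : P.carrier) : Prop :=
  ∀ ζ : GammaPow K p n, GammaPow.InLevel ζ k →
    P.act ζ (x ⊗ₜ[K] 1) = x ⊗ₜ[K] GammaPow.padicPow ζ k a

/-- For every power of a primitive `p^k`-th root of unity, acting on the `r`-th variable only, the
cleared relation holds; comparing Fourier coefficients separates the residue classes. -/
theorem GammaModule.det_mul_residuePart [Fact p.Prime] (hp : (p : K) ≠ 0)
    (P : GammaModule.{u, v} K p 𝓕) {m : ℕ}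
    (e : Module.Basis (Fin m) (LaurentRing K 𝓕) P.carrier) (k : ℕ)
    (S W : Matrix (Fin m) (Fin m) (LaurentRing K 𝓕)) (A B : Fin m → Fin n → ℤ_[p])
    (hS : ∀ j, P.IsEigen k (A j) (∑ i, S i j • e i))
    (hW : ∀ j, P.IsEigen k (B j) (∑ i, W i j • e i))
    (r : Fin n) (i j : Fin m) (a : ZMod (p ^ k)) :
    S.det * residuePart r a ((S.adjugate * W) i j) =
      residuePart r (a + PadicInt.toZModPow k (A i r - B j r)) S.det *
        (S.adjugate * W) i j := by
  obtain ⟨z, hz⟩ := exists_isPrimitiveRoot_kGamma hp k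
  set d := S.det
  set g := (S.adjugate * W) i j
  set α := PadicInt.toZModPow k (A i r)
  set β := PadicInt.toZModPow k (B j r)
  -- The character values `ζ^{A_i}` and `ζ^{B_j}` shift the residue class by `α` and `β`, so this
  -- difference collects what multiplies `(z^t)^c` on the two sides. Reading it at `c = a + α` gives
  -- the claim.
  have key := eq_zero_of_sum_tmul_pow_eq_zero hz
    (fun c => d * residuePart r (c - α) g - residuePart r (c - β) d * g) (fun t => ?_) (a + α)
  · rw [add_sub_cancel_right, sub_eq_zero] at key
    rw [key, map_sub, add_sub_assoc]
  have hzt : (z ^ t) ^ p ^ k = 1 := by rw [← pow_mul, mul_comm, pow_mul, hz.pow_eq_one, one_pow]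
  let y : (KGamma K p)ˣ := Units.ofPowEqOne (z ^ t) (p ^ k) hzt (NeZero.ne _)
  have hy : y ^ p ^ k = 1 := Units.pow_ofPowEqOne hzt (NeZero.ne _)
  have hrel := P.det_mul_adjugate_mul e (GammaPow.single r y hy) (dilate r (z ^ t) hzt)
    (LaurentRingGamma.twist_single r y hy hzt) S W
    (fun j => (z ^ t) ^ (PadicInt.toZModPow k (A j r)).val)
    (fun j => (z ^ t) ^ (PadicInt.toZModPow k (B j r)).val)
    (fun j => (hS j _ (GammaPow.single_inLevel r y hy)).trans
      (by rw [GammaPow.padicPow_single]; rfl))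
    (fun j => (hW j _ (GammaPow.single_inLevel r y hy)).trans
      (by rw [GammaPow.padicPow_single]; rfl)) i j
  rw [dilate_apply, dilate_apply, Finset.mul_sum, Finset.sum_mul] at hrel
  simp_rw [Algebra.TensorProduct.tmul_mul_tmul] at hrel
  simp_rw [sub_tmul]
  rw [Finset.sum_sub_distrib, sub_eq_zero, ← Equiv.sum_comp (Equiv.addRight α),
    ← Equiv.sum_comp (Equiv.addRight β) fun c => (residuePart r (c - β) d * g) ⊗ₜ[K] _]
  simp only [Equiv.coe_addRight, add_sub_cancel_right, pow_zmod_val_add hzt]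
  rw [← hrel]
  exact Finset.sum_congr rfl fun c _ => by rw [mul_comm ((z ^ t) ^ c.val)]

end Relation

/-- `|t| / p^k` is a candidate in the infimum defining `angle`; the sign of `t` decides which of the
two alternatives it satisfies. -/
theorem pow_mul_angle_le {p : ℕ} [Fact p.Prime] {k : ℕ} {x : ℤ_[p]} {t : ℤ}
    (h : PadicInt.toZModPow k x = (t : ZMod (p ^ k))) :
    (p : ℝ) ^ k * angle ((x : ℚ_[p]) / (p : ℚ_[p]) ^ k) ≤ |(t : ℝ)| := by
  have hp1 : (0 : ℝ) < (p : ℝ) ^ k := pow_pos (by exact_mod_cast (Fact.out : p.Prime).pos) _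
  have hmem : x - t ∈ RingHom.ker (PadicInt.toZModPow (p := p) k) := by
    rw [RingHom.mem_ker, map_sub, h, map_intCast, sub_self]
  rw [PadicInt.ker_toZModPow, ← PadicInt.norm_le_pow_iff_mem_span_pow] at hmem
  have hnorm : ‖((x : ℚ_[p]) / (p : ℚ_[p]) ^ k) - (t : ℚ_[p]) / (p : ℚ_[p]) ^ k‖ ≤ 1 := by
    rw [← sub_div, norm_div, norm_pow, Padic.norm_p, inv_pow, div_inv_eq_mul]
    have h1 : ‖(x : ℚ_[p]) - (t : ℚ_[p])‖ ≤ (p : ℝ) ^ (-(k : ℤ)) := by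
      rw [PadicInt.norm_def] at hmem
      simpa using hmem
    rw [zpow_neg, zpow_natCast] at h1
    calc _ ≤ ((p : ℝ) ^ k)⁻¹ * (p : ℝ) ^ k := mul_le_mul_of_nonneg_right h1 hp1.le
      _ = 1 := inv_mul_cancel₀ hp1.ne'
  have hle : angle ((x : ℚ_[p]) / (p : ℚ_[p]) ^ k) ≤ |(t : ℝ)| / (p : ℝ) ^ k := by
    refine csInf_le ⟨0, fun a ha => ha.1⟩ ⟨by positivity, |t|, k, by push_cast; rfl, ?_⟩
    rcases abs_choice t with ht | ht
    · left; rw [ht]; exact hnorm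
    · right; rw [ht]; push_cast; rw [neg_div, ← sub_eq_add_neg]; exact hnorm
  calc _ ≤ (p : ℝ) ^ k * (|(t : ℝ)| / (p : ℝ) ^ k) := mul_le_mul_of_nonneg_left hle hp1.le
    _ = _ := mul_div_cancel₀ _ hp1.ne'

/-! ### Moving the radius in one direction to bound exponents. -/

section Scale

variable {n : ℕ}

/-- The multiradius `ρ` with its `r`-th entry multiplied by `exp t`. -/
def Radius.scale (ρ : Radius n) (r : Fin n) (t : ℝ) : Radius n := fun s =>
  ⟨ρ s * Real.exp (if s = r then t else 0), mul_pos (ρ s).2 (Real.exp_pos _)⟩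

theorem Radius.scale_zero (ρ : Radius n) (r : Fin n) : ρ.scale r 0 = ρ := by
  funext s
  simp [scale]

theorem Radius.continuous_scale (ρ : Radius n) (r : Fin n) : Continuous (ρ.scale r) := by
  refine continuous_pi fun s => Continuous.subtype_mk ?_ _
  split_ifs <;> fun_prop

theorem Radius.mono_scale (ρ : Radius n) (r : Fin n) (t : ℝ) (i : Fin n → ℤ) :
    (ρ.scale r t).mono i = ρ.mono i * Real.exp (t * i r) := by
  simp only [mono, scale, mul_zpow, Finset.prod_mul_distrib]
  congr 1
  rw [Finset.prod_eq_single r]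
  · rw [if_pos rfl, Real.exp_mul, Real.rpow_intCast]
  · intro s _ hs
    rw [if_neg hs, Real.exp_zero, one_zpow]
  · simp

theorem Radius.exists_scale_mem {ρ : Radius n} {X : Set (Radius n)} (hX : X ∈ 𝓝 ρ) :
    ∃ ε : ℝ, 0 < ε ∧ ∀ r, ρ.scale r ε ∈ X ∧ ρ.scale r (-ε) ∈ X := by
  have h : ∀ᶠ t : ℝ in 𝓝 0, ∀ r, ρ.scale r t ∈ X := eventually_all.2 fun r => by
    have := (ρ.continuous_scale r).tendsto 0
    rw [ρ.scale_zero] at this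
    exact this.eventually hX
  obtain ⟨ε, hε, hball⟩ := Metric.eventually_nhds_iff.1 h
  refine ⟨ε / 2, half_pos hε, fun r => ⟨hball ?_ r, hball ?_ r⟩⟩ <;>
    simp [abs_of_pos hε, hε]

variable {K : Type u} [NontriviallyNormedField K] [CompleteSpace K] [IsUltrametricDist K]
  {𝓕 : Filter (Radius n)} [NeBot 𝓕]

/-- A term of `f` that is not small at `ρ` has an `r`-th exponent that is bounded in terms of the
Gauss norms of `f` at the radii obtained by moving `ρ` in the `r`-th direction. -/
theorem mul_abs_exponent_le {ρ : Radius n} {r : Fin n} {ε : ℝ} {f : LaurentRing K 𝓕}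
    (h₁ : ConvergesAt f.1 (ρ.scale r ε)) (h₂ : ConvergesAt f.1 (ρ.scale r (-ε))) {k : ℕ} {D G : ℝ}
    (hD : 0 < D) (hG : 0 < G)
    (hf₁ : f.gaussNorm (ρ.scale r ε) ≤ D ^ k) (hf₂ : f.gaussNorm (ρ.scale r (-ε)) ≤ D ^ k)
    {i : Fin n → ℤ} (hi : 1 ≤ G ^ k * (‖f.1 i‖ * ρ.mono i)) :
    ε * |(i r : ℝ)| ≤ k * Real.log (G * D) := by
  -- Rescaling by `exp t` multiplies the term by `exp (t * i r)`. It is at least `G^(-k)` before and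
  -- at most `D^k` after, so `exp (t * i r) ≤ (G * D)^k`; both signs of `t = ±ε` are needed for the
  -- absolute value.
  have key : ∀ t : ℝ, ‖f.1 i‖ * (ρ.scale r t).mono i ≤ D ^ k →
      t * i r ≤ k * Real.log (G * D) := by
    intro t ht
    rw [Radius.mono_scale, ← mul_assoc] at ht
    rw [← Real.log_pow, Real.le_log_iff_exp_le (by positivity), mul_pow]
    calc Real.exp (t * i r) ≤ G ^ k * (‖f.1 i‖ * ρ.mono i) * Real.exp (t * i r) :=
          le_mul_of_one_le_left (Real.exp_pos _).le hi
      _ = G ^ k * (‖f.1 i‖ * ρ.mono i * Real.exp (t * i r)) := mul_assoc _ _ _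
      _ ≤ _ := mul_le_mul_of_nonneg_left ht (by positivity)
  have hp := key ε ((LaurentRing.le_gaussNorm h₁ i).trans hf₁)
  have hn := key (-ε) ((LaurentRing.le_gaussNorm h₂ i).trans hf₂)
  rcases abs_choice (i r : ℝ) with h | h <;> rw [h] <;> linarith

end Scale

/-! ### Growth estimates and the construction of the permutations. -/

section Core

variable {K : Type u} [NontriviallyNormedField K] [CompleteSpace K] [IsUltrametricDist K]
  {p : ℕ} [Fact p.Prime] {n m : ℕ}

theorem gaussNorm_adjugate_mul_le {X : Set (Radius n)} [NeBot (𝓟 X)] {σ : Radius n} (hσ : σ ∈ X)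
    {S U T : Matrix (Fin m) (Fin m) (LaurentRing K (𝓟 X))} {C M : ℝ} (hC : 1 ≤ C) (hM : 0 ≤ M)
    (hS : ∀ i j, (S i j).gaussNorm σ ≤ C) (hT : ∀ i j, (T i j).gaussNorm σ ≤ C)
    (hU : ∀ i j, (U i j).gaussNorm σ ≤ M) (i j : Fin m) :
    ((S.adjugate * (U * T)) i j).gaussNorm σ ≤ C ^ m * (M * C) := by
  have hle : pure σ ≤ 𝓟 X := by simpa using hσ
  let φ : LaurentRing K (𝓟 X) →+* LaurentRing K (pure σ) :=
    (LaurentRing.restrict (K := K) hle).toRingHom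
  have hmap : φ ((S.adjugate * (U * T)) i j) =
      ((S.map φ).adjugate * (U.map φ * T.map φ)) i j := by
    have hadj : (S.map φ).adjugate = S.adjugate.map φ := (φ.map_adjugate S).symm
    rw [hadj, ← Matrix.map_mul, ← Matrix.map_mul, Matrix.map_apply]
  change gaussAbv σ (φ ((S.adjugate * (U * T)) i j)) ≤ _
  rw [hmap]
  have hv := gaussAbv_isNonarchimedean (K := K) σ
  exact abv_mul_le hv (by positivity) (by positivity) (abv_adjugate_le hv hC hS)
    (abv_mul_le hv hM (zero_le_one.trans hC) hU hT) i j

theorem gaussNorm_det_le {X : Set (Radius n)} [NeBot (𝓟 X)] {σ : Radius n} (hσ : σ ∈ X)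
    {S : Matrix (Fin m) (Fin m) (LaurentRing K (𝓟 X))} {C : ℝ}
    (hS : ∀ i j, (S i j).gaussNorm σ ≤ C) : S.det.gaussNorm σ ≤ C ^ m := by
  have hle : pure σ ≤ 𝓟 X := by simpa using hσ
  let φ : LaurentRing K (𝓟 X) →+* LaurentRing K (pure σ) :=
    (LaurentRing.restrict (K := K) hle).toRingHom
  have hmap : φ S.det = (S.map φ).det := φ.map_det S
  change gaussAbv σ (φ S.det) ≤ _
  rw [hmap]
  exact abv_det_le (gaussAbv_isNonarchimedean (K := K) σ) hS

/-- The determinant of `adj(S) U T` is `(det S)^(m-1) det U det T`, and the factors from `S` and `T`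
have norm at least `1`. -/
theorem exists_perm_gaussNorm_det_le {X : Set (Radius n)} [NeBot (𝓟 X)] {σ : Radius n}
    (hσ : σ ∈ X) (S U T : Matrix (Fin m) (Fin m) (LaurentRing K (𝓟 X)))
    (hS : 1 ≤ S.det.gaussNorm σ) (hT : 1 ≤ T.det.gaussNorm σ) :
    ∃ s : Equiv.Perm (Fin m),
      U.det.gaussNorm σ ≤ ∏ j, ((S.adjugate * (U * T)) (s j) j).gaussNorm σ := by
  have hle : pure σ ≤ 𝓟 X := by simpa using hσ
  let φ : LaurentRing K (𝓟 X) →+* LaurentRing K (pure σ) :=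
    (LaurentRing.restrict (K := K) hle).toRingHom
  obtain ⟨s, hs⟩ := exists_perm_abv_det_le (gaussAbv_isNonarchimedean (K := K) σ)
    ((S.adjugate * (U * T)).map φ)
  refine ⟨s, le_trans ?_ hs⟩
  have hmap : ((S.adjugate * (U * T)).map φ).det =
      φ S.det ^ (m - 1) * (φ U.det * φ T.det) := by
    have : φ (S.adjugate * (U * T)).det = ((S.adjugate * (U * T)).map φ).det := φ.map_det _
    rw [← this, Matrix.det_mul, Matrix.det_mul, Matrix.det_adjugate, Fintype.card_fin, map_mul,
      map_mul, map_pow]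
  rw [hmap, map_mul, map_mul, map_pow]
  have h1 : 1 ≤ gaussAbv σ (φ S.det) ^ (m - 1) := one_le_pow₀ hS
  have h2 : (0 : ℝ) ≤ gaussAbv σ (φ U.det) := (gaussAbv σ).nonneg _
  change gaussAbv σ (φ U.det) ≤ _
  calc gaussAbv σ (φ U.det) ≤ gaussAbv σ (φ U.det) * gaussAbv σ (φ T.det) :=
        le_mul_of_one_le_right h2 hT
    _ ≤ _ := le_mul_of_one_le_left (mul_nonneg h2 ((gaussAbv σ).nonneg _)) h1

/-- Two Laurent series related by a shift `δ` of residue classes have dominant terms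
whose exponents differ by `δ`. -/
theorem exists_dominant_pair {𝓕 : Filter (Radius n)} [NeBot 𝓕] {ρ : Radius n} {N : ℕ} {r : Fin n}
    {d g : LaurentRing K 𝓕} (hd : ConvergesAt d.1 ρ) (hg : ConvergesAt g.1 ρ)
    (hd0 : 0 < d.gaussNorm ρ) (hg0 : 0 < g.gaussNorm ρ) {δ : ZMod N}
    (h : ∀ a, d * residuePart r a g = residuePart r (a + δ) d * g) :
    ∃ i j : Fin n → ℤ, d.gaussNorm ρ ≤ ‖d.1 i‖ * ρ.mono i ∧ g.gaussNorm ρ ≤ ‖g.1 j‖ * ρ.mono j ∧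
      δ = ((i r - j r : ℤ) : ZMod N) := by
  have hpart : ∀ {f : LaurentRing K 𝓕} (a : ZMod N), ConvergesAt f.1 ρ →
      ConvergesAt (residuePart r a f).1 ρ := fun {f} a hf => hf.of_le fun i => by
    by_cases hi : ((i r : ℤ) : ZMod N) = a
    · rw [residuePart_apply_of_eq f hi]
    · rw [residuePart_apply_of_ne f hi, norm_zero]; exact norm_nonneg _
  obtain ⟨i, hi⟩ := LaurentRing.exists_eq_gaussNorm hd
  set b : ZMod N := ((i r : ℤ) : ZMod N)
  have h1 : d.gaussNorm ρ ≤ (residuePart r b d).gaussNorm ρ := by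
    have h2 := LaurentRing.le_gaussNorm (hpart b hd) i
    rwa [residuePart_apply_of_eq d rfl, hi] at h2
  -- With this `a`, the part of `d` on the right contains a dominant term of `d`. Cancelling the
  -- norm of `d` then shows that the part of `g` has at least the full norm of `g`.
  have h3 := congrArg (LaurentRing.gaussNorm ρ) (h (b - δ))
  rw [sub_add_cancel, LaurentRing.gaussNorm_mul hd (hpart _ hg),
    LaurentRing.gaussNorm_mul (hpart _ hd) hg] at h3
  have h4 : g.gaussNorm ρ ≤ (residuePart r (b - δ) g).gaussNorm ρ := by
    refine le_of_mul_le_mul_left ?_ hd0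
    rw [h3]
    exact mul_le_mul_of_nonneg_right h1 hg0.le
  obtain ⟨j, hj⟩ := LaurentRing.exists_eq_gaussNorm (hpart (b - δ) hg)
  have hjr : ((j r : ℤ) : ZMod N) = b - δ := by
    by_contra hne
    rw [residuePart_apply_of_ne g hne, norm_zero, zero_mul] at hj
    linarith
  refine ⟨i, j, hi.ge, ?_, ?_⟩
  · rw [residuePart_apply_of_eq g hjr] at hj
    rw [hj]; exact h4
  · rw [Int.cast_sub, hjr]; ring

/-- The analytic half of the argument: the relation produces small integer representatives of
`A_{s(j)} - B_j` modulo `p^k`, with all constants independent of `k`. -/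
theorem weaklyEquivalent_of_relation {ρ : Radius n} {X : Set (Radius n)} [NeBot (𝓟 X)]
    (hX : X ∈ 𝓝 ρ) {A B : Fin m → Fin n → ℤ_[p]}
    (U : Matrix (Fin m) (Fin m) (LaurentRing K (𝓟 X))) (hU : U.det ≠ 0)
    (S T : ℕ → Matrix (Fin m) (Fin m) (LaurentRing K (𝓟 X))) {C : ℝ} (hC : 1 ≤ C)
    (hS : ∀ k, 0 < k → ∀ σ ∈ X, ∀ i j, (S k i j).gaussNorm σ ≤ C ^ k)
    (hT : ∀ k, 0 < k → ∀ σ ∈ X, ∀ i j, (T k i j).gaussNorm σ ≤ C ^ k)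
    (hSdet : ∀ k, 0 < k → 1 ≤ (S k).det.gaussNorm ρ)
    (hTdet : ∀ k, 0 < k → 1 ≤ (T k).det.gaussNorm ρ)
    (hrel : ∀ k, 0 < k → ∀ (r : Fin n) (i j : Fin m) (a : ZMod (p ^ k)),
      (S k).det * residuePart r a (((S k).adjugate * (U * T k)) i j) =
        residuePart r (a + PadicInt.toZModPow k (A i r - B j r)) (S k).det *
          ((S k).adjugate * (U * T k)) i j) :
    WeaklyEquivalent A B := by
  have hρ : ρ ∈ X := mem_of_mem_nhds hX
  have hconv : ∀ (f : LaurentRing K (𝓟 X)), ∀ σ ∈ X, ConvergesAt f.1 σ := fun f =>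
    eventually_principal.1 f.2
  obtain ⟨ε, hε, hεX⟩ := Radius.exists_scale_mem hX
  -- Only these finitely many radii enter, so `U` has a common bound `M` on them although it need
  -- not be bounded on `X`.
  let Y : Set (Radius n) :=
    {ρ} ∪ (Set.range fun r => ρ.scale r ε) ∪ Set.range fun r => ρ.scale r (-ε)
  have hYX : Y ⊆ X := by
    rintro σ ((rfl | ⟨r, rfl⟩) | ⟨r, rfl⟩)
    exacts [hρ, (hεX r).1, (hεX r).2]
  have hYfin : Y.Finite :=
    ((Set.finite_singleton _).union (Set.finite_range _)).union (Set.finite_range _)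
  obtain ⟨M, hM1, hM⟩ : ∃ M : ℝ, 1 ≤ M ∧ ∀ σ ∈ Y, ∀ i j, (U i j).gaussNorm σ ≤ M := by
    obtain ⟨M, hM⟩ := ((hYfin.prod (Set.toFinite (Set.univ : Set (Fin m × Fin m)))).image
      fun x => (U x.2.1 x.2.2).gaussNorm x.1).bddAbove
    exact ⟨max 1 M, le_max_left _ _, fun σ hσ i j =>
      (hM ⟨(σ, (i, j)), ⟨hσ, trivial⟩, rfl⟩).trans (le_max_right _ _)⟩
  -- The factors bound the adjugate of `S_k`, then `U`, then `T_k`. As `M ≥ 1` and `k ≥ 1`, `M` may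
  -- be replaced by `M^k`, which makes the bound a pure `k`-th power.
  set D : ℝ := C ^ m * (M * C) with hD
  have hMC : 1 ≤ M * C := one_le_mul_of_one_le_of_one_le hM1 hC
  have hD1 : 1 ≤ D := one_le_mul_of_one_le_of_one_le (one_le_pow₀ hC) hMC
  have hd_le : ∀ k, 0 < k → ∀ σ ∈ Y, (S k).det.gaussNorm σ ≤ D ^ k := by
    intro k hk σ hσ
    refine (gaussNorm_det_le (hYX hσ) (hS k hk σ (hYX hσ))).trans ?_
    rw [pow_right_comm]
    exact pow_le_pow_left₀ (by positivity) (le_mul_of_one_le_right (by positivity) hMC) k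
  have hN_le : ∀ k, 0 < k → ∀ σ ∈ Y, ∀ i j,
      (((S k).adjugate * (U * T k)) i j).gaussNorm σ ≤ D ^ k := by
    intro k hk σ hσ i j
    refine (gaussNorm_adjugate_mul_le (hYX hσ) (one_le_pow₀ hC) (by positivity)
      (hS k hk σ (hYX hσ)) (hT k hk σ (hYX hσ))
      (fun i j => (hM σ hσ i j).trans (le_self_pow₀ hM1 hk.ne')) i j).trans_eq ?_
    rw [hD, mul_pow, mul_pow, pow_right_comm]
  have hρY : ρ ∈ Y := Or.inl (Or.inl rfl)
  have hu : 0 < U.det.gaussNorm ρ :=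
    LaurentRing.gaussNorm_pos (hconv _ ρ hρ) fun h => hU (LaurentRing.ext h)
  -- Being at least `1`, `V` satisfies `V^k * |det U|_ρ ≥ 1` for every `k ≥ 1`, so the fixed loss
  -- from `U` fits the exponential form.
  set V : ℝ := max 1 (U.det.gaussNorm ρ)⁻¹
  have hV1 : 1 ≤ V := le_max_left _ _
  set G : ℝ := V * D ^ m with hG
  have hG1 : 1 ≤ G := one_le_mul_of_one_le_of_one_le hV1 (one_le_pow₀ hD1)
  have hperm : ∀ k, ∃ s : Equiv.Perm (Fin m), 0 < k → ∀ j,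
      1 ≤ G ^ k * (((S k).adjugate * (U * T k)) (s j) j).gaussNorm ρ := by
    intro k
    by_cases hk : 0 < k
    swap
    · exact ⟨1, fun h => absurd h hk⟩
    obtain ⟨s, hs⟩ := exists_perm_gaussNorm_det_le hρ (S k) U (T k) (hSdet k hk) (hTdet k hk)
    refine ⟨s, fun _ j => ?_⟩
    set x := fun j => (((S k).adjugate * (U * T k)) (s j) j).gaussNorm ρ
    have hx0 : ∀ j, 0 ≤ x j := fun j => LaurentRing.gaussNorm_nonneg _
    -- Bounding the other `m - 1` factors by `D^k` turns the lower bound on the product into one on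
    -- each single factor.
    have hprod : ∏ j, x j ≤ x j * (D ^ m) ^ k := by
      rw [← Finset.mul_prod_erase _ _ (Finset.mem_univ j)]
      refine mul_le_mul_of_nonneg_left ?_ (hx0 j)
      calc ∏ j ∈ Finset.univ.erase j, x j ≤ ∏ _j ∈ Finset.univ.erase j, D ^ k :=
            Finset.prod_le_prod (fun j _ => hx0 j) fun j _ => hN_le k hk ρ hρY (s j) j
        _ = (D ^ k) ^ (m - 1) := by simp
        _ ≤ (D ^ k) ^ m := pow_le_pow_right₀ (one_le_pow₀ hD1) (Nat.sub_le m 1)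
        _ = _ := pow_right_comm _ _ _
    have hVu : 1 ≤ V ^ k * U.det.gaussNorm ρ := by
      calc 1 = (U.det.gaussNorm ρ)⁻¹ * U.det.gaussNorm ρ := (inv_mul_cancel₀ hu.ne').symm
        _ ≤ V ^ k * U.det.gaussNorm ρ := mul_le_mul_of_nonneg_right
            ((le_max_right _ _).trans (le_self_pow₀ hV1 hk.ne')) hu.le
    calc 1 ≤ V ^ k * U.det.gaussNorm ρ := hVu
      _ ≤ V ^ k * (x j * (D ^ m) ^ k) :=
          mul_le_mul_of_nonneg_left (hs.trans hprod) (by positivity)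
      _ = G ^ k * x j := by rw [hG, mul_pow]; ring
  choose s hs using hperm
  have hlog : 0 ≤ Real.log (G * D) := Real.log_nonneg (one_le_mul_of_one_le_of_one_le hG1 hD1)
  -- The two dominant exponents contribute `k * log (G * D) / ε` each; the extra `1` keeps the
  -- constant positive when the logarithm vanishes.
  refine ⟨2 * Real.log (G * D) / ε + 1, by positivity, s, fun k hk r j => ?_⟩
  have hgpos : 0 < (((S k).adjugate * (U * T k)) (s k j) j).gaussNorm ρ :=
    pos_of_mul_pos_right (zero_lt_one.trans_le (hs k hk j)) (by positivity)
  obtain ⟨i₁, i₂, h₁, h₂, hδ⟩ := exists_dominant_pair (hconv _ ρ hρ) (hconv _ ρ hρ)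
    (zero_lt_one.trans_le (hSdet k hk)) hgpos (hrel k hk r (s k j) j)
  have hY₁ : ρ.scale r ε ∈ Y := Or.inl (Or.inr ⟨r, rfl⟩)
  have hY₂ : ρ.scale r (-ε) ∈ Y := Or.inr ⟨r, rfl⟩
  have b₁ := mul_abs_exponent_le (hconv _ _ (hεX r).1) (hconv _ _ (hεX r).2)
    (D := D) (G := G) (by positivity) (by positivity)
    (hd_le k hk _ hY₁) (hd_le k hk _ hY₂) (i := i₁)
    (one_le_mul_of_one_le_of_one_le (one_le_pow₀ hG1) ((hSdet k hk).trans h₁))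
  have b₂ := mul_abs_exponent_le (hconv _ _ (hεX r).1) (hconv _ _ (hεX r).2)
    (D := D) (G := G) (by positivity) (by positivity)
    (hN_le k hk _ hY₁ (s k j) j) (hN_le k hk _ hY₂ (s k j) j) (i := i₂)
    ((hs k hk j).trans (mul_le_mul_of_nonneg_left h₂ (by positivity)))
  refine (pow_mul_angle_le hδ).trans ?_
  push_cast
  have h5 : ε * |(i₁ r : ℝ) - i₂ r| ≤ 2 * Real.log (G * D) * k := by
    have := mul_le_mul_of_nonneg_left (abs_sub (i₁ r : ℝ) (i₂ r)) hε.le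
    linarith
  have h6 : |(i₁ r : ℝ) - i₂ r| ≤ 2 * Real.log (G * D) / ε * k := by
    rw [div_mul_eq_mul_div, le_div_iff₀ hε, mul_comm]
    exact h5
  have h7 : (0 : ℝ) ≤ k := k.cast_nonneg
  linarith

end Core

/-! ### Comparing two models of the same object near `ρ`. -/

section Models

variable {K : Type u} [NontriviallyNormedField K] [CompleteSpace K] [IsUltrametricDist K]
  {p : ℕ} {n : ℕ} {ρ : Radius n} {P : GammaModule.{u, v} K p (𝓝 ρ)} {J : ClosedPolysegment ρ}

/-- The basis of `P` induced by a basis of a model of `P`. -/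
def Model.germBasis (P' : Model.{u, v, w} P J) {m : ℕ}
    (e : Module.Basis (Fin m) (PolyannulusRing K J) P'.toGammaModule.carrier) :
    Module.Basis (Fin m) (GermRing K ρ) P.carrier :=
  (e.baseChange (GermRing K ρ)).map P'.extend

theorem Model.sum_smul_germBasis (P' : Model.{u, v, w} P J) {m : ℕ}
    (e : Module.Basis (Fin m) (PolyannulusRing K J) P'.toGammaModule.carrier)
    (s : Fin m → PolyannulusRing K J) :
    ∑ i, LaurentRing.restrict (K := K) J.nhds_le (s i) • P'.germBasis e i =
      P'.extend (1 ⊗ₜ[PolyannulusRing K J] ∑ i, s i • e i) := by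
  rw [tmul_sum, map_sum]
  refine Finset.sum_congr rfl fun i _ => ?_
  rw [germBasis, Module.Basis.map_apply, Module.Basis.baseChange_apply, ← map_smul]
  congr 1
  rw [tmul_smul]
  exact algebraMap_smul (GermRing K ρ) (s i)
    ((1 : GermRing K ρ) ⊗ₜ[PolyannulusRing K J] e i)

/-- Compatibility of the actions, read on `x ⊗ 1`: `gammaMap` sends `x ⊗ c` to the image of `x` in
`P` tensored with `c`. -/
theorem Model.isEigen_extend [Fact p.Prime] (P' : Model.{u, v, w} P J) {k : ℕ}
    {a : Fin n → ℤ_[p]} {x : P'.toGammaModule.carrier} (hx : P'.toGammaModule.IsEigen k a x) :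
    P.IsEigen k a (P'.extend (1 ⊗ₜ[PolyannulusRing K J] x)) := fun ζ hζ => by
  have h := P'.act_extend ζ (x ⊗ₜ[K] 1)
  rw [hx ζ hζ] at h
  exact h.symm

/-- The algebraic relation is available over the germ ring, where both bases live in `P`, while the
estimates need fixed radii around `ρ`. Both are reconciled on a common neighbourhood. -/
theorem Model.weaklyEquivalent [Fact p.Prime] (hp : (p : K) ≠ 0) {J₁ J₂ : ClosedPolysegment ρ}
    (P₁ : Model.{u, v, w₁} P J₁) (P₂ : Model.{u, v, w₂} P J₂) {m : ℕ}
    {A B : Fin m → Fin n → ℤ_[p]} (hA : P₁.IsExponent A) (hB : P₂.IsExponent B) :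
    WeaklyEquivalent A B := by
  obtain ⟨e, S, hSact, ⟨l₁, hl₁, hSle⟩, hSdet⟩ := hA
  obtain ⟨f, T, hTact, ⟨l₂, hl₂, hTle⟩, hTdet⟩ := hB
  set b := P₁.germBasis e
  set b' := P₂.germBasis f
  set U := b.toMatrix b'
  -- A neighbourhood of `ρ`, since `U` has finitely many entries and each is a germ; on it `S_k`,
  -- `T_k` and `U` all converge.
  let X : Set (Radius n) := {σ | (σ ∈ J₁.toSet ∧ σ ∈ J₂.toSet) ∧ ∀ i j, ConvergesAt (U i j).1 σ}
  have hX : X ∈ 𝓝 ρ :=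
    (eventually_and.2 ⟨J₁.mem_nhds, J₂.mem_nhds⟩).and
      (eventually_all.2 fun i => eventually_all.2 fun j => (U i j).2)
  have hρX : 𝓝 ρ ≤ 𝓟 X := le_principal_iff.2 hX
  have : NeBot (𝓟 X) := neBot_of_le hρX
  have hJ₁ : 𝓟 X ≤ J₁.filter := principal_mono.2 fun σ hσ => hσ.1.1
  have hJ₂ : 𝓟 X ≤ J₂.filter := principal_mono.2 fun σ hσ => hσ.1.2
  let φ₁ : PolyannulusRing K J₁ →+* LaurentRing K (𝓟 X) :=
    (LaurentRing.restrict (K := K) hJ₁).toRingHom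
  let φ₂ : PolyannulusRing K J₂ →+* LaurentRing K (𝓟 X) :=
    (LaurentRing.restrict (K := K) hJ₂).toRingHom
  let ψ : LaurentRing K (𝓟 X) →+* GermRing K ρ := (LaurentRing.restrict (K := K) hρX).toRingHom
  let U' : Matrix (Fin m) (Fin m) (LaurentRing K (𝓟 X)) := Matrix.of fun i j =>
    ⟨(U i j).1, eventually_principal.2 fun σ hσ => hσ.2 i j⟩
  have hψinj : Function.Injective ψ := fun x y h =>
    LaurentRing.ext (congrArg (fun z : GermRing K ρ => z.1) h)
  have hψU : U'.map ψ = U := rfl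
  have hψpart : ∀ {N : ℕ} (r : Fin n) (a : ZMod N) x, ψ (residuePart r a x) =
      residuePart r a (ψ x) := fun r a x => rfl
  have hp1 : (1 : ℝ) ≤ p := by exact_mod_cast (Fact.out : p.Prime).one_le
  have hpow : ∀ {l : ℝ}, l ≤ max l₁ l₂ → ∀ k : ℕ,
      (p : ℝ) ^ (l * k) ≤ ((p : ℝ) ^ max l₁ l₂) ^ k := fun {l} hl k => by
    rw [Real.rpow_mul (zero_le_one.trans hp1), Real.rpow_natCast]
    exact pow_le_pow_left₀ (by positivity) (Real.rpow_le_rpow_of_exponent_le hp1 hl) k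
  refine weaklyEquivalent_of_relation hX U' ?_ (fun k => (S k).map φ₁) (fun k => (T k).map φ₂)
    (C := (p : ℝ) ^ max l₁ l₂) (Real.one_le_rpow hp1 (hl₁.le.trans (le_max_left _ _)))
    (fun k hk σ hσ i j => (hSle k hk i j σ hσ.1.1).trans (hpow (le_max_left _ _) k))
    (fun k hk σ hσ i j => (hTle k hk i j σ hσ.1.2).trans (hpow (le_max_right _ _) k))
    (fun k hk => ?_) (fun k hk => ?_) (fun k hk r i j a => ?_)
  · intro h0
    have h1 : U.det = 0 := by
      have h2 : ψ U'.det = (U'.map ψ).det := ψ.map_det U'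
      rw [← hψU, ← h2, h0, map_zero]
    have h3 := congrArg Matrix.det (b.toMatrix_mul_toMatrix_flip b')
    rw [Matrix.det_mul, Matrix.det_one] at h3
    change U.det * _ = 1 at h3
    rw [h1, zero_mul] at h3
    exact zero_ne_one h3
  · have h1 : φ₁ (S k).det = ((S k).map φ₁).det := φ₁.map_det (S k)
    rw [← h1]
    exact hSdet k hk ρ (mem_of_mem_nhds J₁.mem_nhds)
  · have h1 : φ₂ (T k).det = ((T k).map φ₂).det := φ₂.map_det (T k)
    rw [← h1]
    exact hTdet k hk ρ (mem_of_mem_nhds J₂.mem_nhds)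
  set S' := ((S k).map φ₁).map ψ
  set T' := ((T k).map φ₂).map ψ
  have hS' : ∀ j, P.IsEigen k (A j) (∑ i, S' i j • b i) := fun j => by
    have h := P₁.sum_smul_germBasis e fun i => S k i j
    have h2 := P₁.isEigen_extend (k := k) (a := A j) fun ζ hζ => hSact k hk ζ hζ j
    rw [← h] at h2
    exact h2
  have hT' : ∀ j, P.IsEigen k (B j) (∑ i, T' i j • b' i) := fun j => by
    have h := P₂.sum_smul_germBasis f fun i => T k i j
    have h2 := P₂.isEigen_extend (k := k) (a := B j) fun ζ hζ => hTact k hk ζ hζ j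
    rw [← h] at h2
    exact h2
  have hW : ∀ j, ∑ i, (U * T') i j • b i = ∑ i, T' i j • b' i := fun j => by
    simp_rw [Matrix.mul_apply, Finset.sum_smul]
    rw [Finset.sum_comm]
    refine Finset.sum_congr rfl fun l _ => ?_
    rw [← b.sum_toMatrix_smul_self b' l, Finset.smul_sum]
    exact Finset.sum_congr rfl fun i _ => by rw [smul_smul, mul_comm]
  have hrel := P.det_mul_residuePart hp b k S' (U * T') A B hS' (fun j => by
    rw [hW]; exact hT' j) r i j a
  have hdet : ψ ((S k).map φ₁).det = S'.det := ψ.map_det _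
  have hN : ψ ((((S k).map φ₁).adjugate * (U' * (T k).map φ₂)) i j) =
      (S'.adjugate * (U * T')) i j := by
    have hadj : S'.adjugate = ((S k).map φ₁).adjugate.map ψ := (ψ.map_adjugate _).symm
    rw [hadj, ← hψU, ← Matrix.map_mul, ← Matrix.map_mul, Matrix.map_apply]
  -- Passing to germs leaves the coefficients unchanged, so the relation descends from the germ ring
  -- to `X`.
  apply hψinj
  rw [map_mul, map_mul, hψpart, hψpart, hdet, hN]
  exact hrel

end Models

end PFuchs

end

theorem mainTheorem7 {K : Type u} [NontriviallyNormedField K] [CompleteSpace K]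
    [IsUltrametricDist K] [CharZero K] (p : ℕ) [Fact p.Prime] (hp : ‖(p : K)‖ = (p : ℝ)⁻¹)
    {n : ℕ} (hn : 0 < n) (ρ : PFuchs.Radius n) (P : PFuchs.CObj.{u, v} K p ρ) :
    (∀ (J₁ J₂ : PFuchs.ClosedPolysegment ρ)
      (P₁ : PFuchs.Model.{u, v, w₁} P.toGammaModule J₁)
      (P₂ : PFuchs.Model.{u, v, w₂} P.toGammaModule J₂)
      (m : ℕ) (A B : Fin m → Fin n → ℤ_[p]),
      P₁.IsExponent A → P₂.IsExponent B → PFuchs.WeaklyEquivalent A B) ∧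
    (∀ (m : ℕ) (A B : Fin m → Fin n → ℤ_[p]),
      P.IsExponent A → P.IsExponent B → PFuchs.WeaklyEquivalent A B) := by
  have hp0 : (p : K) ≠ 0 := Nat.cast_ne_zero.2 (Fact.out : p.Prime).ne_zero
  refine ⟨fun J₁ J₂ P₁ P₂ m A B hA hB => P₁.weaklyEquivalent hp0 P₂ hA hB, ?_⟩
  rintro m A B ⟨J₁, P₁, hA⟩ ⟨J₂, P₂, hB⟩
  exact P₁.weaklyEquivalent hp0 P₂ hA hB
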